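/- A T-mesh $\mathcal T$ consists of a finite set $\mathcal T_2$ of open axis-aligned rectangles (faces), a finite set $\mathcal T_1$ of closed axis-aligned segments (edges) that are contained in boundaries of faces, and the set $\mathcal T_0$ of end points of the edges (vertices), such that the boundary of each face is a union of edges, the closures of two different faces meet only in their boundaries, in a union of edges and vertices, two different edges are disjoint or meet in a single vertex, and $\Omega=\bigcup_{\sigma\in\mathcal T_2}\overline\sigma$ is connected. Edges that meet the interior of $\Omega$, and vertices in the interior of $\Omega$, are called interior; the sets of these are $\mathring{\mathcal T}_1$ and $\mathring{\mathcal T}_0$. The T-mesh is hierarchical if it is obtained from a single rectangle (with its four sides and four corners) by finitely many steps in each of which one face is split into two by a horizontal or vertical line; the new edge between the two parts is added, its end points become vertices, and edges containing such an end point in their relative interior are cut there. A segment is a non-empty set of interior edges, all horizontal or all vertical, whose union is connected (together with the vertices of these edges). Let $m,m'\ge 0$ be integers and let $\mathcal P$ be the space of real polynomials in two variables of bi-degree at most $(m,m')$. A smoothness distribution is a map $\mathbf r:\mathcal T_1\to\mathbb Z_{\ge -1}$ with $\mathbf r(\tau)=-1$ for $\tau\notin\mathring{\mathcal T}_1$.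 It is an $(m+1,m'+1)$ smoothness distribution if $\mathbf r(\tau)\le (m'-1)/2$ for every horizontal edge $\tau$ and $\mathbf r(\tau)\le (m-1)/2$ for every vertical edge $\tau$. Let $\mathcal R^{\mathbf r}$ be the space of functions on the union of the faces whose restriction to each face is in $\mathcal P$ and that are $C^{\mathbf r(\tau)}$ smooth across the relative interior of each interior edge $\tau$ (no condition if $\mathbf r(\tau)=-1$). For $\tau\in\mathring{\mathcal T}_1$ let $\mathfrak J^{\mathbf r}_\tau\subseteq\mathcal P$ be the subspace of all multiples of $\ell_\tau^{\mathbf r(\tau)+1}$, where $\ell_\tau$ is a non-zero linear polynomial vanishing on $\tau$, and for $\gamma\in\mathring{\mathcal T}_0$ let $\mathfrak J^{\mathbf r}_\gamma=\sum_{\tau\ni\gamma}\mathfrak J^{\mathbf r}_\tau$. Let $H_0(\mathcal I^{\mathbf r})$ be the cokernel of the boundary map $\bigoplus_{\tau\in\mathring{\mathcal T}_1}\mathfrak J^{\mathbf r}_\tau\to\bigoplus_{\gamma\in\mathring{\mathcal T}_0}\mathfrak J^{\mathbf r}_\gamma$ (each edge is sent to the difference of its end points, boundary vertices being dropped), and let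 $$\chi(\mathcal Q^{\mathbf r})=\sum_{\sigma\in\mathcal T_2}\dim\mathcal P-\sum_{\tau\in\mathring{\mathcal T}_1}\dim\mathcal P/\mathfrak J^{\mathbf r}_\tau+\sum_{\gamma\in\mathring{\mathcal T}_0}\dim\mathcal P/\mathfrak J^{\mathbf r}_\gamma$$ be the Euler characteristic of the complex $\mathcal Q^{\mathbf r}:\ \bigoplus_{\sigma\in\mathcal T_2}\mathcal P\to\bigoplus_{\tau\in\mathring{\mathcal T}_1}\mathcal P/\mathfrak J^{\mathbf r}_\tau\to\bigoplus_{\gamma\in\mathring{\mathcal T}_0}\mathcal P/\mathfrak J^{\mathbf r}_\gamma\to0$. **Corollary.** Let $\mathcal T$ be a hierarchical T-mesh and let $\mathbf r$ be an $(m+1,m'+1)$ smoothness distribution on $\mathcal T$ such that $\mathbf r(\tau)=\mathbf r(\tau')$ for all edges $\tau,\tau'$ that belong to the same segment. Then $H_0(\mathcal I^{\mathbf r})=0$, and for every smoothness distribution $\mathbf s$ with $\mathbf s(\tau)\le\mathbf r(\tau)$ for all edges $\tau$ of $\mathcal T$, the space $\mathcal R^{\mathbf s}$ is finite-dimensional and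 $$\dim\mathcal R^{\mathbf s}=\chi(\mathcal Q^{\mathbf s}).$$ -/

import Mathlib

open scoped Classical Topology

set_option maxSynthPendingDepth 3

noncomputable section

namespace TSpline

/-! ## Axis-aligned cells of the plane -/

/-- An axis-aligned rectangle of non-zero measure. -/
structure Rect where
  left : ℝ
  right : ℝ
  bottom : ℝ
  top : ℝ
  left_lt_right : left < right
  bottom_lt_top : bottom < top

/-- The open rectangle as a set of points. -/
def Rect.toSet (σ : Rect) : Set (ℝ × ℝ) :=
  Set.Ioo σ.left σ.right ×ˢ Set.Ioo σ.bottom σ.top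

/-- The direction of an axis-aligned edge. -/
inductive Dir where
  | horizontal
  | vertical

/-- The point with coordinate `x` along the direction `d` and coordinate `c` across it. -/
def Dir.point : Dir → ℝ → ℝ → ℝ × ℝ
  | .horizontal, x, c => (x, c)
  | .vertical, x, c => (c, x)

/-- A closed axis-aligned segment of positive length: the points whose coordinate along `dir`
is in `[lo, hi]` and whose coordinate across `dir` is `pos`. -/
structure Edge where
  dir : Dir
  pos : ℝ
  lo : ℝ
  hi : ℝ
  lo_lt_hi : lo < hi

namespace Edge

/-- The edge as a closed set of points. -/
def toSet (τ : Edge) : Set (ℝ × ℝ) :=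
  (fun x => τ.dir.point x τ.pos) '' Set.Icc τ.lo τ.hi

/-- The edge without its two end points. -/
def relInterior (τ : Edge) : Set (ℝ × ℝ) :=
  (fun x => τ.dir.point x τ.pos) '' Set.Ioo τ.lo τ.hi

/-- The left (lower) end point. -/
def src (τ : Edge) : ℝ × ℝ := τ.dir.point τ.lo τ.pos

/-- The right (upper) end point. -/
def tgt (τ : Edge) : ℝ × ℝ := τ.dir.point τ.hi τ.pos

theorem src_mem (τ : Edge) : τ.src ∈ τ.toSet :=
  ⟨τ.lo, ⟨le_refl _, τ.lo_lt_hi.le⟩, rfl⟩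

theorem tgt_mem (τ : Edge) : τ.tgt ∈ τ.toSet :=
  ⟨τ.hi, ⟨τ.lo_lt_hi.le, le_refl _⟩, rfl⟩

/-- The coordinate of a point along the direction of the edge. -/
def along (τ : Edge) (p : ℝ × ℝ) : ℝ :=
  match τ.dir with
  | .horizontal => p.1
  | .vertical => p.2

/-- Cut an edge at the point `p`: two edges if `p` is in the relative interior of the edge,
the edge itself otherwise. -/
def cutAt (p : ℝ × ℝ) (τ : Edge) : Finset Edge :=
  if h : p ∈ τ.relInterior ∧ τ.lo < τ.along p ∧ τ.along p < τ.hi then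
    {⟨τ.dir, τ.pos, τ.lo, τ.along p, h.2.1⟩, ⟨τ.dir, τ.pos, τ.along p, τ.hi, h.2.2⟩}
  else {τ}

end Edge

/-! ## T-meshes -/

/-- Finite sets of faces, edges and vertices. -/
structure MeshData where
  faces : Finset Rect
  edges : Finset Edge
  vertices : Finset (ℝ × ℝ)

namespace MeshData

variable (M : MeshData)

/-- The union of the (open) faces. -/
def faceUnion : Set (ℝ × ℝ) := ⋃ σ ∈ M.faces, σ.toSet

/-- The domain `Ω` of the mesh: the union of the closed faces. -/
def domain : Set (ℝ × ℝ) := ⋃ σ ∈ M.faces, closure σ.toSet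

/-- The edges that meet the interior of the domain. -/
def interiorEdges : Finset Edge :=
  M.edges.filter fun τ => (τ.toSet ∩ interior M.domain).Nonempty

/-- The vertices in the interior of the domain. -/
def interiorVertices : Finset (ℝ × ℝ) :=
  M.vertices.filter fun γ => γ ∈ interior M.domain

/-- The mesh whose only face is `σ`, with the four sides as edges and the four corners as
vertices. -/
def single (σ : Rect) : MeshData where
  faces := {σ}
  edges := {⟨.horizontal, σ.bottom, σ.left, σ.right, σ.left_lt_right⟩,
    ⟨.horizontal, σ.top, σ.left, σ.right, σ.left_lt_right⟩,
    ⟨.vertical, σ.left, σ.bottom, σ.top, σ.bottom_lt_top⟩,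
    ⟨.vertical, σ.right, σ.bottom, σ.top, σ.bottom_lt_top⟩}
  vertices := {(σ.left, σ.bottom), (σ.right, σ.bottom), (σ.left, σ.top), (σ.right, σ.top)}

/-- Split the face `σ` along the horizontal line `y = t`: the face is replaced by its two parts,
the edge between them is added, its end points become vertices, and the edges that contain such
an end point in their relative interior are cut there. -/
def splitHorizontal (σ : Rect) (t : ℝ) (h₁ : σ.bottom < t) (h₂ : t < σ.top) : MeshData where
  faces := {⟨σ.left, σ.right, σ.bottom, t, σ.left_lt_right, h₁⟩,
    ⟨σ.left, σ.right, t, σ.top, σ.left_lt_right, h₂⟩} ∪ M.faces.erase σ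
  edges := {⟨.horizontal, t, σ.left, σ.right, σ.left_lt_right⟩} ∪
    (M.edges.biUnion (Edge.cutAt (σ.left, t))).biUnion (Edge.cutAt (σ.right, t))
  vertices := {(σ.left, t), (σ.right, t)} ∪ M.vertices

/-- Split the face `σ` along the vertical line `x = t`. -/
def splitVertical (σ : Rect) (t : ℝ) (h₁ : σ.left < t) (h₂ : t < σ.right) : MeshData where
  faces := {⟨σ.left, t, σ.bottom, σ.top, h₁, σ.bottom_lt_top⟩,
    ⟨t, σ.right, σ.bottom, σ.top, h₂, σ.bottom_lt_top⟩} ∪ M.faces.erase σ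
  edges := {⟨.vertical, t, σ.bottom, σ.top, σ.bottom_lt_top⟩} ∪
    (M.edges.biUnion (Edge.cutAt (t, σ.bottom))).biUnion (Edge.cutAt (t, σ.top))
  vertices := {(t, σ.bottom), (t, σ.top)} ∪ M.vertices

/-- Hierarchical meshes: obtained from a single rectangle by successively splitting a face along
a horizontal or a vertical line. -/
inductive IsHierarchical : MeshData → Prop
  | single (σ : Rect) : IsHierarchical (single σ)
  | splitHorizontal (M : MeshData) (σ : Rect) (t : ℝ) (h₁ : σ.bottom < t) (h₂ : t < σ.top) :
      IsHierarchical M → σ ∈ M.faces → IsHierarchical (M.splitHorizontal σ t h₁ h₂)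
  | splitVertical (M : MeshData) (σ : Rect) (t : ℝ) (h₁ : σ.left < t) (h₂ : t < σ.right) :
      IsHierarchical M → σ ∈ M.faces → IsHierarchical (M.splitVertical σ t h₁ h₂)

/-- A segment, given by its edges: a non-empty set of interior edges, all horizontal or all
vertical, with connected union. -/
def IsSegment (A : Finset Edge) : Prop :=
  A ⊆ M.interiorEdges ∧ A.Nonempty ∧
    ((∀ τ ∈ A, τ.dir = .horizontal) ∨ (∀ τ ∈ A, τ.dir = .vertical)) ∧
    IsConnected (⋃ τ ∈ A, τ.toSet)

end MeshData

/-- A T-mesh. -/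
structure TMesh extends MeshData where
  edge_of_face : ∀ τ ∈ edges, ∃ σ ∈ faces, τ.toSet ⊆ frontier σ.toSet
  mem_vertices : ∀ γ, γ ∈ vertices ↔ ∃ τ ∈ edges, γ = τ.src ∨ γ = τ.tgt
  frontier_face : ∀ σ ∈ faces, ∃ E ⊆ edges, frontier σ.toSet = ⋃ τ ∈ E, τ.toSet
  face_inter : ∀ σ ∈ faces, ∀ σ' ∈ faces, σ ≠ σ' →
    closure σ.toSet ∩ closure σ'.toSet = frontier σ.toSet ∩ frontier σ'.toSet ∧
    ∃ E ⊆ edges, ∃ V ⊆ vertices,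
      closure σ.toSet ∩ closure σ'.toSet = (⋃ τ ∈ E, τ.toSet) ∪ (V : Set (ℝ × ℝ))
  edge_inter : ∀ τ ∈ edges, ∀ τ' ∈ edges, τ ≠ τ' →
    τ.toSet ∩ τ'.toSet = ∅ ∨ ∃ γ ∈ vertices, τ.toSet ∩ τ'.toSet = {γ}
  isConnected_domain : IsConnected toMeshData.domain

/-! ## Smoothness distributions -/

/-- A smoothness distribution on the edges of `M`, with values in `ℤ_{≥ -1}`, equal to `-1` on
the edges that are not interior. Only the values on the edges of `M` are ever used. -/
structure SmoothnessDistribution (M : MeshData) where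
  toFun : Edge → ℤ
  neg_one_le : ∀ τ ∈ M.edges, -1 ≤ toFun τ
  eq_neg_one : ∀ τ ∈ M.edges, τ ∉ M.interiorEdges → toFun τ = -1

namespace SmoothnessDistribution

variable {M : MeshData}

/-- `(m+1, m'+1)` smoothness distributions: `r(τ) ≤ (m' - 1) / 2` on horizontal edges and
`r(τ) ≤ (m - 1) / 2` on vertical edges. -/
def IsBoundedBy (r : SmoothnessDistribution M) (m m' : ℕ) : Prop :=
  ∀ τ ∈ M.edges,
    (τ.dir = .horizontal → (r.toFun τ : ℝ) ≤ ((m' : ℝ) - 1) / 2) ∧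
    (τ.dir = .vertical → (r.toFun τ : ℝ) ≤ ((m : ℝ) - 1) / 2)

/-- `r` takes the same value on all edges of each segment. -/
def ConstantOnSegments (r : SmoothnessDistribution M) : Prop :=
  ∀ A, M.IsSegment A → ∀ τ ∈ A, ∀ τ' ∈ A, r.toFun τ = r.toFun τ'

end SmoothnessDistribution

/-! ## Polynomials and splines -/

/-- Polynomials in the two coordinates of bi-degree at most `(m, m')`. -/
def biPoly (m m' : ℕ) : Submodule ℝ (MvPolynomial (Fin 2) ℝ) :=
  Submodule.span ℝ {q | ∃ i ≤ m, ∃ j ≤ m', q = MvPolynomial.X 0 ^ i * MvPolynomial.X 1 ^ j}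

/-- The value of a polynomial at a point of the plane. -/
def evalAt (p : MvPolynomial (Fin 2) ℝ) (x : ℝ × ℝ) : ℝ := MvPolynomial.eval ![x.1, x.2] p

variable (M : MeshData)

/-- A function given on the union of the open faces is `C^k` smooth across the edge `τ`: near
each relative interior point of `τ` it is the restriction of a `C^k` function. There is no
condition for `k = -1`. -/
def SmoothAcross (f : M.faceUnion → ℝ) (τ : Edge) (k : ℤ) : Prop :=
  0 ≤ k → ∀ x ∈ τ.relInterior, ∃ F : ℝ × ℝ → ℝ, ContDiffAt ℝ (k.toNat : ℕ∞) F x ∧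
    ∀ᶠ y in 𝓝 x, ∀ hy : y ∈ M.faceUnion, F y = f ⟨y, hy⟩

/-- The space `R^r` of splines of bi-degree at most `(m, m')` and smoothness `r`, as functions on
the union of the open faces. -/
def splineSpace (r : SmoothnessDistribution M) (m m' : ℕ) : Submodule ℝ (M.faceUnion → ℝ) where
  carrier := {f |
    (∀ σ ∈ M.faces, ∃ p ∈ biPoly m m', ∀ x : M.faceUnion, x.1 ∈ σ.toSet → f x = evalAt p x.1) ∧
    ∀ τ ∈ M.interiorEdges, SmoothAcross M f τ (r.toFun τ)}
  zero_mem' := by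
    refine ⟨fun σ _ => ⟨0, Submodule.zero_mem _, fun x _ => by simp [evalAt]⟩, fun τ _ _ x _ => ?_⟩
    exact ⟨fun _ => 0, contDiffAt_const, Filter.Eventually.of_forall fun y hy => rfl⟩
  add_mem' := by
    rintro f g ⟨hf, hf'⟩ ⟨hg, hg'⟩
    refine ⟨fun σ hσ => ?_, fun τ hτ hk x hx => ?_⟩
    · obtain ⟨p, hp, hfp⟩ := hf σ hσ
      obtain ⟨q, hq, hgq⟩ := hg σ hσ
      exact ⟨p + q, Submodule.add_mem _ hp hq, fun x hx => by
        simp [evalAt, hfp x hx, hgq x hx]⟩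
    · obtain ⟨F, hF, hfF⟩ := hf' τ hτ hk x hx
      obtain ⟨G, hG, hgG⟩ := hg' τ hτ hk x hx
      refine ⟨F + G, hF.add hG, ?_⟩
      filter_upwards [hfF, hgG] with y h1 h2 hy
      simp [h1 hy, h2 hy]
  smul_mem' := by
    rintro c f ⟨hf, hf'⟩
    refine ⟨fun σ hσ => ?_, fun τ hτ hk x hx => ?_⟩
    · obtain ⟨p, hp, hfp⟩ := hf σ hσ
      exact ⟨c • p, Submodule.smul_mem _ c hp, fun x hx => by
        simp [evalAt, hfp x hx]⟩
    · obtain ⟨F, hF, hfF⟩ := hf' τ hτ hk x hx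
      refine ⟨fun y => c * F y, contDiffAt_const.mul hF, ?_⟩
      filter_upwards [hfF] with y h1 hy
      simp [h1 hy]

/-! ## The complexes `I^r` and `Q^r` -/

/-- A non-zero linear polynomial vanishing on the edge. -/
def Edge.linearForm (τ : Edge) : MvPolynomial (Fin 2) ℝ :=
  match τ.dir with
  | .horizontal => MvPolynomial.X 1 - MvPolynomial.C τ.pos
  | .vertical => MvPolynomial.X 0 - MvPolynomial.C τ.pos

section Complexes

variable {M}
variable (r : SmoothnessDistribution M) (m m' : ℕ)

/-- `J_τ`: the polynomials of bi-degree at most `(m, m')` that are multiples of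
`ℓ_τ ^ (r(τ) + 1)`. -/
def edgeJ (τ : Edge) : Submodule ℝ (biPoly m m') :=
  ((Ideal.span {τ.linearForm ^ (r.toFun τ + 1).toNat}).restrictScalars ℝ).comap
    (biPoly m m').subtype

/-- `J_γ`: the sum of the spaces `J_τ` over the edges `τ` that contain `γ`. -/
def vertexJ (γ : ℝ × ℝ) : Submodule ℝ (biPoly m m') :=
  ⨆ τ ∈ M.edges, ⨆ _ : γ ∈ τ.toSet, edgeJ r m m' τ

variable (M)

/-- The boundary map `[τ] p ↦ [tgt τ] p - [src τ] p` from interior edges to interior vertices,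
where boundary vertices are dropped. -/
def boundary :
    (M.interiorEdges → biPoly m m') →ₗ[ℝ] (M.interiorVertices → biPoly m m') :=
  LinearMap.pi fun γ => ∑ τ : M.interiorEdges,
    ((if γ.1 = τ.1.tgt then 1 else 0) - (if γ.1 = τ.1.src then 1 else 0) : ℝ) • LinearMap.proj τ

variable {M}

/-- `I^r_1`, the direct sum of the `J_τ` over the interior edges. -/
def idealOne : Submodule ℝ (M.interiorEdges → biPoly m m') :=
  Submodule.pi Set.univ fun τ => edgeJ r m m' τ.1

/-- `I^r_0`, the direct sum of the `J_γ` over the interior vertices. -/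
def idealZero : Submodule ℝ (M.interiorVertices → biPoly m m') :=
  Submodule.pi Set.univ fun γ => vertexJ r m m' γ.1

theorem edgeJ_le_vertexJ {τ : Edge} (hτ : τ ∈ M.edges) {γ : ℝ × ℝ} (hγ : γ ∈ τ.toSet) :
    edgeJ r m m' τ ≤ vertexJ r m m' γ :=
  le_iSup₂_of_le τ hτ (le_iSup_of_le hγ le_rfl)

theorem boundary_mem {x : M.interiorEdges → biPoly m m'} (hx : x ∈ idealOne r m m') :
    boundary M m m' x ∈ idealZero r m m' := by
  intro γ _
  simp only [boundary, LinearMap.pi_apply, LinearMap.sum_apply, LinearMap.smul_apply,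
    LinearMap.proj_apply]
  refine Submodule.sum_mem _ fun τ _ => ?_
  have hτ : τ.1 ∈ M.edges := (Finset.mem_filter.mp τ.2).1
  have hxτ : x τ ∈ edgeJ r m m' τ.1 := hx τ (Set.mem_univ _)
  by_cases h1 : γ.1 = τ.1.tgt
  · exact Submodule.smul_mem _ _ (edgeJ_le_vertexJ r m m' hτ (h1 ▸ τ.1.tgt_mem) hxτ)
  · by_cases h2 : γ.1 = τ.1.src
    · exact Submodule.smul_mem _ _ (edgeJ_le_vertexJ r m m' hτ (h2 ▸ τ.1.src_mem) hxτ)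
    · simp [h1, h2]

/-- The differential `I^r_1 → I^r_0`. -/
def idealBoundary : idealOne r m m' →ₗ[ℝ] idealZero r m m' :=
  (boundary M m m').restrict fun _ hx => boundary_mem r m m' hx

/-- `H_0(I^r)`, the homology of `I^r_1 → I^r_0 → 0` at `I^r_0`. -/
abbrev idealHomologyZero : Type :=
  idealZero r m m' ⧸ LinearMap.range (idealBoundary r m m')

/-- `Q^r_2`, the direct sum of copies of the polynomial space over the faces. -/
abbrev quotTwo (M : MeshData) (m m' : ℕ) : Type := M.faces → biPoly m m'

/-- `Q^r_1`, the direct sum over the interior edges of the quotients by `J_τ`. -/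
abbrev quotOne : Type := (τ : M.interiorEdges) → biPoly m m' ⧸ edgeJ r m m' τ.1

/-- `Q^r_0`, the direct sum over the interior vertices of the quotients by `J_γ`. -/
abbrev quotZero : Type := (γ : M.interiorVertices) → biPoly m m' ⧸ vertexJ r m m' γ.1

/-- The Euler characteristic of the complex `Q^r_2 → Q^r_1 → Q^r_0 → 0`. -/
def eulerChar : ℤ :=
  (Module.finrank ℝ (quotTwo M m m') : ℤ) - (Module.finrank ℝ (quotOne r m m') : ℤ)
    + (Module.finrank ℝ (quotZero r m m') : ℤ)

end Complexes

end TSpline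

end

/-!
The splines of a smoothness distribution `s` are the kernel of the map
`⨁_σ P → ⨁_τ P / J_τ` that sends a family of polynomials on the faces to its jumps across the
interior edges (`IsTiling.splineSpace_eq_map`): a piecewise polynomial function is `C^k` across an
edge if and only if the jump is divisible by `ℓ_τ ^ (k + 1)`. The sequence
`⨁_σ P → ⨁_τ P → ⨁_γ P → 0` of jumps and boundaries is exact (`Built.range_jumpMap`,
`boundary_surjective`). If moreover the boundary map sends `⨁ J_τ` onto `⨁ J_γ`, that is
`H_0(I^s) = 0`, then the sequence of the quotients is exact as well, and counting dimensions gives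
the formula (`finrank_comap_add_finrank_quotient`).

The vanishing of `H_0(I^r)` says that the multiples of vertices by elements of the spaces `J_τ` of
adjacent edges are boundaries. For constant smoothness along segments this is proved by induction
on the construction of the mesh (`Built.isBoundary`). Cutting an edge into two with the same space
`J` changes nothing. An edge `τ` that splits a face ends at two older edges `v₁`, `v₂` perpendicular
to it (or on the boundary of the domain, where there is nothing to prove). By the degree bound,
powers of the linear forms of `v₁` and `v₂` generate all polynomials of the given degree in the
variable along `τ`, so that every element of `J_τ` is a sum of elements of `J_τ ∩ J_{v₁}` and
`J_τ ∩ J_{v₂}` (`exists_add_of_linearForm_pow_dvd`). Elements of `J_τ` can be moved from one end of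
`τ` to the other, and each summand is a boundary at the end where it belongs to an older edge. The
same splitting reduces `H_0(I^s) = 0` to `H_0(I^r) = 0` for `s ≤ r` (`IsBoundary.of_le`), since in a
hierarchical mesh every interior vertex is an end point of edges in both directions. For `r = -1`
the argument shows that the boundary map with coefficients in `P` is onto.

Geometrically, a hierarchical mesh is built by cutting single edges and by splitting faces between
existing vertices (`Built`). Each step preserves the properties in `IsTiling`, the main ones being
that the faces tile the rectangle in each of the four half-open senses, and that their sides are
covered by edges. That the jumps around an interior point add up to zero follows by comparing the
four faces that contain the four quadrants at this point; conversely a chain without boundary is a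
family of jumps by induction on the construction (`Built.exists_jump`).
-/

noncomputable section

namespace TSpline

section

open MvPolynomial

/-! ### Coordinates in an arbitrary direction -/

/-- The other direction. -/
def Dir.flip : Dir → Dir
  | .horizontal => .vertical
  | .vertical => .horizontal

@[simp] theorem Dir.flip_flip (d : Dir) : d.flip.flip = d := by cases d <;> rfl

theorem Dir.eq_or_eq_flip (d d' : Dir) : d' = d ∨ d' = d.flip := by
  cases d <;> cases d' <;> simp [Dir.flip]

/-- The coordinate of a point along the direction `d`. -/
def Dir.coord : Dir → ℝ × ℝ → ℝ
  | .horizontal, p => p.1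
  | .vertical, p => p.2

@[simp] theorem Dir.coord_point (d : Dir) (x c : ℝ) : d.coord (d.point x c) = x := by
  cases d <;> rfl

@[simp] theorem Dir.coord_flip_point (d : Dir) (x c : ℝ) : d.flip.coord (d.point x c) = c := by
  cases d <;> rfl

theorem Dir.eq_point_iff (d : Dir) (p : ℝ × ℝ) (x c : ℝ) :
    p = d.point x c ↔ d.coord p = x ∧ d.flip.coord p = c := by
  cases d <;> simp [Dir.point, Dir.coord, Dir.flip, Prod.ext_iff, and_comm]

/-- The index of the variable that is the coordinate along the direction `d`. -/
def Dir.var : Dir → Fin 2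
  | .horizontal => 0
  | .vertical => 1

theorem Dir.var_flip_ne (d : Dir) : d.flip.var ≠ d.var := by
  cases d <;> simp [Dir.flip, Dir.var]

/-- The bound `m` or `m'` on the degree in the variable along the direction `d`. -/
def Dir.deg (m m' : ℕ) : Dir → ℕ
  | .horizontal => m
  | .vertical => m'

/-! ### Polynomials of bounded bi-degree -/

/-- The product of a polynomial `f` in the variable along `d` and the `j`-th power of the linear
form in the other variable that vanishes at `b`. -/
def lineTerm (d : Dir) (b : ℝ) (f : Polynomial ℝ) (j : ℕ) : MvPolynomial (Fin 2) ℝ :=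
  Polynomial.aeval (X d.var) f * (X d.flip.var - C b) ^ j

theorem Edge.linearForm_eq (τ : Edge) : τ.linearForm = X τ.dir.flip.var - C τ.pos := by
  unfold Edge.linearForm
  cases h : τ.dir <;> rfl

theorem X_mul_X_mem_biPoly (d : Dir) {m m' i j : ℕ} (hi : i ≤ d.deg m m')
    (hj : j ≤ d.flip.deg m m') :
    (X d.var ^ i * X d.flip.var ^ j : MvPolynomial (Fin 2) ℝ) ∈ biPoly m m' := by
  apply Submodule.subset_span
  cases d
  · exact ⟨i, hi, j, hj, rfl⟩
  · exact ⟨j, hj, i, hi, mul_comm _ _⟩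

theorem aeval_mul_aeval_mem_biPoly (d : Dir) {m m' : ℕ} {f g : Polynomial ℝ}
    (hf : f.natDegree ≤ d.deg m m') (hg : g.natDegree ≤ d.flip.deg m m') :
    Polynomial.aeval (X d.var) f * Polynomial.aeval (X d.flip.var) g ∈ biPoly m m' := by
  rw [Polynomial.aeval_eq_sum_range, Polynomial.aeval_eq_sum_range, Finset.sum_mul_sum]
  refine Submodule.sum_mem _ fun i hi => Submodule.sum_mem _ fun j hj => ?_
  rw [smul_mul_smul_comm]
  apply Submodule.smul_mem
  rw [Finset.mem_range] at hi hj
  exact X_mul_X_mem_biPoly d (by omega) (by omega)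

theorem lineTerm_mem_biPoly (d : Dir) (b : ℝ) {m m' j : ℕ} {f : Polynomial ℝ}
    (hf : f.natDegree ≤ d.deg m m') (hj : j ≤ d.flip.deg m m') :
    lineTerm d b f j ∈ biPoly m m' := by
  have h := aeval_mul_aeval_mem_biPoly d (m := m) (m' := m') hf
    (g := (Polynomial.X - Polynomial.C b) ^ j) (by simpa using hj)
  simpa [lineTerm, algebraMap_eq] using h

theorem lineTerm_add (d : Dir) (b : ℝ) (f g : Polynomial ℝ) (j : ℕ) :
    lineTerm d b (f + g) j = lineTerm d b f j + lineTerm d b g j := by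
  simp [lineTerm, add_mul]

theorem lineTerm_smul (d : Dir) (b c : ℝ) (f : Polynomial ℝ) (j : ℕ) :
    lineTerm d b (c • f) j = c • lineTerm d b f j := by
  simp [lineTerm]

/-- Expansion of a polynomial of bounded bi-degree in powers of a linear form. -/
theorem exists_eq_sum_lineTerm (d : Dir) (b : ℝ) {m m' : ℕ} {p : MvPolynomial (Fin 2) ℝ}
    (hp : p ∈ biPoly m m') :
    ∃ f : ℕ → Polynomial ℝ, (∀ j, (f j).natDegree ≤ d.deg m m') ∧
      p = ∑ j ∈ Finset.range (d.flip.deg m m' + 1), lineTerm d b (f j) j := by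
  induction hp using Submodule.span_induction with
  | mem q hq =>
    obtain ⟨i, hi, j, hj, hq⟩ : ∃ i ≤ d.deg m m', ∃ j ≤ d.flip.deg m m',
        q = X d.var ^ i * X d.flip.var ^ j := by
      obtain ⟨i, hi, j, hj, rfl⟩ := hq
      cases d
      · exact ⟨i, hi, j, hj, rfl⟩
      · exact ⟨j, hj, i, hi, mul_comm _ _⟩
    let g := Polynomial.taylor b (Polynomial.X ^ j : Polynomial ℝ)
    have hg : g.natDegree ≤ j := by simp [g]
    refine ⟨fun l => g.coeff l • Polynomial.X ^ i, fun l =>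
      (Polynomial.natDegree_smul_le _ _).trans (by simpa using hi), ?_⟩
    have hX := Polynomial.sum_taylor_eq (Polynomial.X ^ j : Polynomial ℝ) b
    rw [Polynomial.sum_over_range' _ (by simp) (d.flip.deg m m' + 1)
      (Nat.lt_succ_of_le (hg.trans hj))] at hX
    apply_fun Polynomial.aeval (X d.flip.var : MvPolynomial (Fin 2) ℝ) at hX
    rw [map_pow, Polynomial.aeval_X] at hX
    rw [hq, ← hX, map_sum, Finset.mul_sum]
    refine Finset.sum_congr rfl fun l _ => ?_
    simp only [lineTerm, map_mul, map_pow, map_sub, Polynomial.aeval_X, Polynomial.aeval_C,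
      map_smul, algebraMap_eq, smul_eq_C_mul, g]
    ring
  | zero => exact ⟨0, by simp, by simp [lineTerm]⟩
  | add p q _ _ hp hq =>
    obtain ⟨f, hf, rfl⟩ := hp
    obtain ⟨g, hg, rfl⟩ := hq
    refine ⟨f + g, fun j => (Polynomial.natDegree_add_le _ _).trans (max_le (hf j) (hg j)), ?_⟩
    simp [lineTerm_add, Finset.sum_add_distrib]
  | smul c p _ hp =>
    obtain ⟨f, hf, rfl⟩ := hp
    refine ⟨c • f, fun j => (Polynomial.natDegree_smul_le _ _).trans (hf j), ?_⟩
    simp [lineTerm_smul, Finset.smul_sum]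

/-- The restriction of a polynomial to the line across the direction `d` through the point with
coordinates `t` along `d` and `b` across `d`, in the parameter that is `0` at this point. -/
def crossRestrict (d : Dir) (b t : ℝ) : MvPolynomial (Fin 2) ℝ →ₐ[ℝ] Polynomial ℝ :=
  MvPolynomial.aeval fun i =>
    if i = d.var then Polynomial.C t else Polynomial.X + Polynomial.C b

theorem crossRestrict_linearForm (τ : Edge) (t : ℝ) :
    crossRestrict τ.dir τ.pos t τ.linearForm = Polynomial.X := by
  rw [Edge.linearForm_eq]
  simp [crossRestrict, Dir.var_flip_ne, ← algebraMap_eq, ← Polynomial.algebraMap_eq]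

theorem eval_crossRestrict (d : Dir) (b t u : ℝ) (p : MvPolynomial (Fin 2) ℝ) :
    (crossRestrict d b t p).eval u = evalAt p (d.point t (b + u)) := by
  unfold evalAt crossRestrict
  induction p using MvPolynomial.induction_on with
  | C a => simp [← algebraMap_eq]
  | add p q hp hq => simp [hp, hq]
  | mul_X p i hp =>
    rw [map_mul, Polynomial.eval_mul, hp, map_mul]
    congr 1
    cases d <;> fin_cases i <;> simp [Dir.var, Dir.point, add_comm]

theorem crossRestrict_lineTerm (d : Dir) (b t : ℝ) (f : Polynomial ℝ) (j : ℕ) :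
    crossRestrict d b t (lineTerm d b f j) = Polynomial.C (f.eval t) * Polynomial.X ^ j := by
  have h1 : crossRestrict d b t (X d.flip.var - C b) = Polynomial.X := by
    simp [crossRestrict, Dir.var_flip_ne, ← algebraMap_eq, ← Polynomial.algebraMap_eq]
  have h2 : crossRestrict d b t (X d.var) = Polynomial.C t := by simp [crossRestrict]
  rw [lineTerm, map_mul, map_pow, h1, ← Polynomial.aeval_algHom_apply, h2]
  congr 1
  rw [← Polynomial.algebraMap_eq, Polynomial.aeval_algebraMap_apply]
  simp

/-- A polynomial of bounded bi-degree whose restrictions to infinitely many lines across an edge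
vanish to order `k` on the edge is a combination of the terms of order at least `k`. -/
theorem exists_eq_sum_lineTerm_of_dvd (d : Dir) (b : ℝ) {m m' k : ℕ}
    {p : MvPolynomial (Fin 2) ℝ} (hp : p ∈ biPoly m m') {S : Set ℝ} (hS : S.Infinite)
    (h : ∀ t ∈ S, Polynomial.X ^ k ∣ crossRestrict d b t p) :
    ∃ f : ℕ → Polynomial ℝ, (∀ j, (f j).natDegree ≤ d.deg m m') ∧
      p = ∑ j ∈ Finset.Ico k (d.flip.deg m m' + 1), lineTerm d b (f j) j := by
  obtain ⟨f, hf, rfl⟩ := exists_eq_sum_lineTerm d b hp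
  refine ⟨f, hf, ?_⟩
  symm
  apply Finset.sum_subset
  · intro j hj
    simp at hj ⊢
    exact hj.2
  · intro j hj hjk
    simp only [Finset.mem_range, Finset.mem_Ico, not_and_or, not_le, not_lt] at hj hjk
    have hjk : j < k := by omega
    suffices f j = 0 by simp [this, lineTerm]
    apply Polynomial.eq_zero_of_infinite_isRoot
    refine hS.mono fun t ht => ?_
    have h1 := Polynomial.X_pow_dvd_iff.mp (h t ht) j hjk
    simp only [map_sum, crossRestrict_lineTerm, Polynomial.finsetSum_coeff,
      Polynomial.coeff_C_mul_X_pow] at h1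
    rw [Finset.sum_eq_single j (by intro l _ hl; simp [hl.symm])
      (by intro h; exact absurd (Finset.mem_range.mpr hj) h)] at h1
    simpa using h1

theorem linearForm_pow_dvd_lineTerm (τ : Edge) (f : Polynomial ℝ) {j k : ℕ} (h : k ≤ j) :
    τ.linearForm ^ k ∣ lineTerm τ.dir τ.pos f j := by
  rw [Edge.linearForm_eq]
  exact Dvd.dvd.mul_left (pow_dvd_pow _ h) _

theorem linearForm_pow_dvd_lineTerm_flip (τ : Edge) (b : ℝ) {f : Polynomial ℝ} (j : ℕ) {k : ℕ}
    (h : (Polynomial.X - Polynomial.C τ.pos) ^ k ∣ f) :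
    τ.linearForm ^ k ∣ lineTerm τ.dir.flip b f j := by
  rw [Edge.linearForm_eq]
  apply Dvd.dvd.mul_right
  have := map_dvd (Polynomial.aeval (X τ.dir.flip.var : MvPolynomial (Fin 2) ℝ)) h
  simpa [algebraMap_eq] using this

/-- Divisibility by a power of the linear form of an edge can be tested on lines across it. -/
theorem linearForm_pow_dvd_of_crossRestrict (τ : Edge) {m m' k : ℕ}
    {p : MvPolynomial (Fin 2) ℝ} (hp : p ∈ biPoly m m') {S : Set ℝ} (hS : S.Infinite)
    (h : ∀ t ∈ S, Polynomial.X ^ k ∣ crossRestrict τ.dir τ.pos t p) :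
    τ.linearForm ^ k ∣ p := by
  obtain ⟨f, -, rfl⟩ := exists_eq_sum_lineTerm_of_dvd τ.dir τ.pos hp hS h
  exact Finset.dvd_sum fun j hj => linearForm_pow_dvd_lineTerm τ _ (Finset.mem_Ico.mp hj).1

/-- Powers of two different linear factors of total degree at most `n + 1` generate all
polynomials of degree at most `n` without exceeding the degree `n`. -/
theorem exists_add_of_pow_dvd {a₁ a₂ : ℝ} (ha : a₁ ≠ a₂) {k₁ k₂ n : ℕ} (hk : k₁ + k₂ ≤ n + 1)
    {f : Polynomial ℝ} (hf : f.natDegree ≤ n) :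
    ∃ g₁ g₂ : Polynomial ℝ, f = g₁ + g₂ ∧ g₁.natDegree ≤ n ∧ g₂.natDegree ≤ n ∧
      (Polynomial.X - Polynomial.C a₁) ^ k₁ ∣ g₁ ∧ (Polynomial.X - Polynomial.C a₂) ^ k₂ ∣ g₂ := by
  set A := (Polynomial.X - Polynomial.C a₁) ^ k₁ with hA
  set B := (Polynomial.X - Polynomial.C a₂) ^ k₂ with hB
  have hco : IsCoprime A B :=
    (Polynomial.isCoprime_X_sub_C_of_isUnit_sub (sub_ne_zero.mpr ha).isUnit).pow
  obtain ⟨u, v, huv⟩ := hco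
  have hBm : B.Monic := (Polynomial.monic_X_sub_C a₂).pow k₂
  have hAd : A.natDegree = k₁ := by simp [hA]
  have hBd : B.natDegree = k₂ := by simp [hB]
  set w := (u * f) %ₘ B with hw
  have hg : (A * w).natDegree ≤ n := by
    by_cases h0 : k₂ = 0
    · have : B = 1 := by simp [hB, h0]
      simp [hw, this]
    · have h1 : w.natDegree < B.natDegree :=
        Polynomial.natDegree_modByMonic_lt _ hBm (fun h => h0 (by rw [← hBd, h]; simp))
      have := Polynomial.natDegree_mul_le (p := A) (q := w)
      omega
  refine ⟨A * w, f - A * w, by ring, hg,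
    (Polynomial.natDegree_sub_le _ _).trans (max_le hf hg), dvd_mul_right _ _, ?_⟩
  have h2 := Polynomial.modByMonic_add_div (u * f) B
  refine ⟨f * v + A * ((u * f) /ₘ B), ?_⟩
  have h3 : w = u * f - B * ((u * f) /ₘ B) := by rw [hw]; linear_combination h2
  rw [h3]
  linear_combination f * (-huv)

/-- A multiple of a power of the linear form of `τ` is the sum of two such multiples, which are
also divisible by given powers of the linear forms of two edges perpendicular to `τ`, provided
that the exponents of these powers are small enough. -/
theorem exists_add_of_linearForm_pow_dvd {m m' : ℕ} (τ v₁ v₂ : Edge) (h₁ : v₁.dir = τ.dir.flip)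
    (h₂ : v₂.dir = τ.dir.flip) (hv : v₁.pos ≠ v₂.pos) {k k₁ k₂ : ℕ}
    (hk : k₁ + k₂ ≤ τ.dir.deg m m' + 1) {p : MvPolynomial (Fin 2) ℝ} (hp : p ∈ biPoly m m')
    (hd : τ.linearForm ^ k ∣ p) :
    ∃ q₁ q₂ : MvPolynomial (Fin 2) ℝ, p = q₁ + q₂ ∧ q₁ ∈ biPoly m m' ∧ q₂ ∈ biPoly m m' ∧
      τ.linearForm ^ k ∣ q₁ ∧ τ.linearForm ^ k ∣ q₂ ∧
      v₁.linearForm ^ k₁ ∣ q₁ ∧ v₂.linearForm ^ k₂ ∣ q₂ := by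
  obtain ⟨f, hf, rfl⟩ := exists_eq_sum_lineTerm_of_dvd (k := k) τ.dir τ.pos hp
    Set.infinite_univ fun t _ => by
      have := map_dvd (crossRestrict τ.dir τ.pos t) hd
      rwa [map_pow, crossRestrict_linearForm] at this
  choose g₁ g₂ hg hd₁ hd₂ hg₁ hg₂ using fun j => exists_add_of_pow_dvd hv hk (hf j)
  have e₁ : τ.dir = v₁.dir.flip := by simp [h₁]
  have e₂ : τ.dir = v₂.dir.flip := by simp [h₂]
  refine ⟨∑ j ∈ Finset.Ico k (τ.dir.flip.deg m m' + 1), lineTerm τ.dir τ.pos (g₁ j) j,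
    ∑ j ∈ Finset.Ico k (τ.dir.flip.deg m m' + 1), lineTerm τ.dir τ.pos (g₂ j) j, ?_, ?_, ?_, ?_,
    ?_, ?_, ?_⟩
  · rw [← Finset.sum_add_distrib]
    exact Finset.sum_congr rfl fun j _ => by rw [hg j, lineTerm_add]
  · exact Submodule.sum_mem _ fun j hj => lineTerm_mem_biPoly _ _ (hd₁ j)
      (by have := (Finset.mem_Ico.mp hj).2; omega)
  · exact Submodule.sum_mem _ fun j hj => lineTerm_mem_biPoly _ _ (hd₂ j)
      (by have := (Finset.mem_Ico.mp hj).2; omega)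
  · exact Finset.dvd_sum fun j hj => linearForm_pow_dvd_lineTerm τ _ (Finset.mem_Ico.mp hj).1
  · exact Finset.dvd_sum fun j hj => linearForm_pow_dvd_lineTerm τ _ (Finset.mem_Ico.mp hj).1
  · exact Finset.dvd_sum fun j hj => by
      rw [e₁]; exact linearForm_pow_dvd_lineTerm_flip v₁ _ _ (hg₁ j)
  · exact Finset.dvd_sum fun j hj => by
      rw [e₂]; exact linearForm_pow_dvd_lineTerm_flip v₂ _ _ (hg₂ j)

instance (m m' : ℕ) : FiniteDimensional ℝ (biPoly m m') := by
  apply FiniteDimensional.span_of_finite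
  refine ((Set.finite_Iic m).prod (Set.finite_Iic m')).image
    (fun ij => (X 0 ^ ij.1 * X 1 ^ ij.2 : MvPolynomial (Fin 2) ℝ)) |>.subset ?_
  rintro q ⟨i, hi, j, hj, rfl⟩
  exact ⟨(i, j), ⟨hi, hj⟩, rfl⟩

end

section

/-! ### Rectangles and edges in an arbitrary direction -/

/-- The smaller end of the projection of a rectangle to the axis `d`. -/
def Rect.lo (σ : Rect) : Dir → ℝ
  | .horizontal => σ.left
  | .vertical => σ.bottom

/-- The larger end of the projection of a rectangle to the axis `d`. -/
def Rect.hi (σ : Rect) : Dir → ℝ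
  | .horizontal => σ.right
  | .vertical => σ.top

theorem Rect.lo_lt_hi (σ : Rect) (d : Dir) : σ.lo d < σ.hi d := by
  cases d
  · exact σ.left_lt_right
  · exact σ.bottom_lt_top

theorem Rect.mem_toSet (σ : Rect) (d : Dir) (p : ℝ × ℝ) : p ∈ σ.toSet ↔
    (σ.lo d < d.coord p ∧ d.coord p < σ.hi d) ∧
      (σ.lo d.flip < d.flip.coord p ∧ d.flip.coord p < σ.hi d.flip) := by
  cases d <;> simp [Rect.toSet, Rect.lo, Rect.hi, Dir.coord, Dir.flip, and_comm]

theorem Rect.closure_toSet (σ : Rect) :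
    closure σ.toSet = Set.Icc σ.left σ.right ×ˢ Set.Icc σ.bottom σ.top := by
  rw [Rect.toSet, closure_prod_eq, closure_Ioo σ.left_lt_right.ne, closure_Ioo σ.bottom_lt_top.ne]

theorem Rect.interior_closure_toSet (σ : Rect) : interior (closure σ.toSet) = σ.toSet := by
  rw [Rect.closure_toSet, interior_prod_eq, interior_Icc, interior_Icc, Rect.toSet]

/-- The part of `σ` below the value `t` of the coordinate `d`. -/
def Rect.lower (σ : Rect) (d : Dir) (t : ℝ) (h : σ.lo d < t) : Rect :=
  match d, h with
  | .horizontal, h => ⟨σ.left, t, σ.bottom, σ.top, h, σ.bottom_lt_top⟩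
  | .vertical, h => ⟨σ.left, σ.right, σ.bottom, t, σ.left_lt_right, h⟩

/-- The part of `σ` above the value `t` of the coordinate `d`. -/
def Rect.upper (σ : Rect) (d : Dir) (t : ℝ) (h : t < σ.hi d) : Rect :=
  match d, h with
  | .horizontal, h => ⟨t, σ.right, σ.bottom, σ.top, h, σ.bottom_lt_top⟩
  | .vertical, h => ⟨σ.left, σ.right, t, σ.top, σ.left_lt_right, h⟩

section

variable (σ : Rect) (d : Dir) (t : ℝ) (h : σ.lo d < t) (h' : t < σ.hi d)

@[simp] theorem Rect.lower_lo (d' : Dir) : (σ.lower d t h).lo d' = σ.lo d' := by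
  cases d <;> cases d' <;> rfl

@[simp] theorem Rect.lower_hi : (σ.lower d t h).hi d = t := by cases d <;> rfl

@[simp] theorem Rect.lower_hi_flip : (σ.lower d t h).hi d.flip = σ.hi d.flip := by cases d <;> rfl

@[simp] theorem Rect.upper_hi (d' : Dir) : (σ.upper d t h').hi d' = σ.hi d' := by
  cases d <;> cases d' <;> rfl

@[simp] theorem Rect.upper_lo : (σ.upper d t h').lo d = t := by cases d <;> rfl

@[simp] theorem Rect.upper_lo_flip : (σ.upper d t h').lo d.flip = σ.lo d.flip := by
  cases d <;> rfl

end

theorem Rect.lower_le (σ : Rect) (d : Dir) {t : ℝ} (h : σ.lo d < t) (h' : t ≤ σ.hi d)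
    (d' : Dir) : σ.lo d' ≤ (σ.lower d t h).lo d' ∧ (σ.lower d t h).hi d' ≤ σ.hi d' := by
  refine ⟨(σ.lower_lo d t h d').ge, ?_⟩
  rcases d.eq_or_eq_flip d' with rfl | rfl
  · exact (σ.lower_hi d' t h).trans_le h'
  · exact (σ.lower_hi_flip d t h).le

theorem Rect.upper_le (σ : Rect) (d : Dir) {t : ℝ} (h : σ.lo d ≤ t) (h' : t < σ.hi d)
    (d' : Dir) : σ.lo d' ≤ (σ.upper d t h').lo d' ∧ (σ.upper d t h').hi d' ≤ σ.hi d' := by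
  refine ⟨?_, (σ.upper_hi d t h' d').le⟩
  rcases d.eq_or_eq_flip d' with rfl | rfl
  · exact h.trans (σ.upper_lo d' t h').ge
  · exact (σ.upper_lo_flip d t h').ge

theorem Edge.mem_toSet (τ : Edge) (p : ℝ × ℝ) : p ∈ τ.toSet ↔
    τ.dir.flip.coord p = τ.pos ∧ τ.lo ≤ τ.dir.coord p ∧ τ.dir.coord p ≤ τ.hi := by
  constructor
  · rintro ⟨x, hx, rfl⟩
    simpa using hx
  · rintro ⟨h1, h2⟩
    exact ⟨τ.dir.coord p, h2, ((τ.dir.eq_point_iff _ _ _).mpr ⟨rfl, h1⟩).symm⟩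

theorem Edge.mem_relInterior (τ : Edge) (p : ℝ × ℝ) : p ∈ τ.relInterior ↔
    τ.dir.flip.coord p = τ.pos ∧ τ.lo < τ.dir.coord p ∧ τ.dir.coord p < τ.hi := by
  constructor
  · rintro ⟨x, hx, rfl⟩
    simpa using hx
  · rintro ⟨h1, h2⟩
    exact ⟨τ.dir.coord p, h2, ((τ.dir.eq_point_iff _ _ _).mpr ⟨rfl, h1⟩).symm⟩

theorem Edge.eq_src_iff (τ : Edge) (p : ℝ × ℝ) :
    p = τ.src ↔ τ.dir.coord p = τ.lo ∧ τ.dir.flip.coord p = τ.pos :=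
  τ.dir.eq_point_iff _ _ _

theorem Edge.eq_tgt_iff (τ : Edge) (p : ℝ × ℝ) :
    p = τ.tgt ↔ τ.dir.coord p = τ.hi ∧ τ.dir.flip.coord p = τ.pos :=
  τ.dir.eq_point_iff _ _ _

theorem Edge.relInterior_subset (τ : Edge) : τ.relInterior ⊆ τ.toSet := by
  intro p hp
  rw [Edge.mem_relInterior] at hp
  rw [Edge.mem_toSet]
  exact ⟨hp.1, hp.2.1.le, hp.2.2.le⟩

theorem Edge.mem_toSet_cases {τ : Edge} {p : ℝ × ℝ} (h : p ∈ τ.toSet) :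
    p ∈ τ.relInterior ∨ p = τ.src ∨ p = τ.tgt := by
  rw [Edge.mem_relInterior, Edge.eq_src_iff, Edge.eq_tgt_iff]
  rw [Edge.mem_toSet] at h
  rcases h.2.1.eq_or_lt with h1 | h1
  · exact Or.inr (Or.inl ⟨h1.symm, h.1⟩)
  · rcases h.2.2.eq_or_lt with h2 | h2
    · exact Or.inr (Or.inr ⟨h2, h.1⟩)
    · exact Or.inl ⟨h.1, h1, h2⟩

theorem Edge.not_mem_relInterior_of_end {τ : Edge} {p : ℝ × ℝ} (h : p = τ.src ∨ p = τ.tgt) :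
    p ∉ τ.relInterior := by
  rw [Edge.mem_relInterior]
  rw [Edge.eq_src_iff, Edge.eq_tgt_iff] at h
  rintro ⟨-, h2, h3⟩
  rcases h with h | h <;> linarith [h.1]

theorem Edge.nonempty_relInterior (τ : Edge) : τ.relInterior.Nonempty :=
  (Set.nonempty_Ioo.mpr τ.lo_lt_hi).image _

/-- Half-open intervals: `[a, b)` for `s = true` and `(a, b]` for `s = false`. The point `x`
belongs to this interval iff the interval `(a, b)` contains the points next to `x` on the right
(for `s = true`) or on the left (for `s = false`). -/
def InGerm (s : Bool) (a b x : ℝ) : Prop :=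
  match s with
  | true => a ≤ x ∧ x < b
  | false => a < x ∧ x ≤ b

theorem InGerm.mem_Icc {s : Bool} {a b x : ℝ} (h : InGerm s a b x) : a ≤ x ∧ x ≤ b := by
  cases s
  · exact ⟨h.1.le, h.2⟩
  · exact ⟨h.1, h.2.le⟩

theorem InGerm.of_mem_Ioo (s : Bool) {a b x : ℝ} (h₁ : a < x) (h₂ : x < b) : InGerm s a b x := by
  cases s
  · exact ⟨h₁, h₂.le⟩
  · exact ⟨h₁.le, h₂⟩

theorem InGerm.mono {s : Bool} {a b a' b' x : ℝ} (h : InGerm s a b x) (ha : a' ≤ a)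
    (hb : b ≤ b') : InGerm s a' b' x := by
  cases s
  · exact ⟨ha.trans_lt h.1, h.2.trans hb⟩
  · exact ⟨ha.trans h.1, h.2.trans_le hb⟩

theorem InGerm.split {s : Bool} {a b x : ℝ} (h : InGerm s a b x) (t : ℝ) :
    InGerm s a t x ∨ InGerm s t b x := by
  cases s <;> simp only [InGerm] at *
  · rcases le_or_gt x t with h1 | h1
    · exact Or.inl ⟨h.1, h1⟩
    · exact Or.inr ⟨h1, h.2⟩
  · rcases lt_or_ge x t with h1 | h1
    · exact Or.inl ⟨h.1, h1⟩
    · exact Or.inr ⟨h1, h.2⟩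

theorem InGerm.disjoint {s : Bool} {a b t x : ℝ} (h : InGerm s a t x) (h' : InGerm s t b x) :
    False := by
  cases s <;> simp only [InGerm] at * <;> linarith

/-- Two intervals with a common germ overlap. -/
theorem InGerm.exists_mem_Ioo {s : Bool} {a b a' b' x : ℝ} (h : InGerm s a b x)
    (h' : InGerm s a' b' x) : ∃ y, (a < y ∧ y < b) ∧ (a' < y ∧ y < b') := by
  cases s <;> simp only [InGerm] at *
  · obtain ⟨y, h1, h2⟩ := exists_between (max_lt h.1 h'.1)
    have := max_lt_iff.mp h1
    exact ⟨y, ⟨this.1, by linarith⟩, this.2, by linarith⟩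
  · obtain ⟨y, h1, h2⟩ := exists_between (lt_min h.2 h'.2)
    have := lt_min_iff.mp h2
    exact ⟨y, ⟨by linarith, this.1⟩, by linarith, this.2⟩

/-- The rectangle contains the points next to `p` in one of the four quadrants at `p`, given by
the signs `s` in the direction `d` and `b` in the other direction. -/
def Rect.Germ (σ : Rect) (d : Dir) (s b : Bool) (p : ℝ × ℝ) : Prop :=
  InGerm s (σ.lo d) (σ.hi d) (d.coord p) ∧ InGerm b (σ.lo d.flip) (σ.hi d.flip) (d.flip.coord p)

theorem Rect.Germ.mono {σ σ' : Rect} {d : Dir} {s b : Bool} {p : ℝ × ℝ} (hg : σ.Germ d s b p)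
    (h : ∀ d', σ'.lo d' ≤ σ.lo d' ∧ σ.hi d' ≤ σ'.hi d') : σ'.Germ d s b p :=
  ⟨hg.1.mono (h _).1 (h _).2, hg.2.mono (h _).1 (h _).2⟩

theorem Rect.germ_flip {σ : Rect} {d : Dir} {s b : Bool} {p : ℝ × ℝ} :
    σ.Germ d.flip b s p ↔ σ.Germ d s b p := by
  simp [Rect.Germ, and_comm]

theorem Rect.germ_of_mem {σ : Rect} {p : ℝ × ℝ} (h : p ∈ σ.toSet) (d : Dir) (s b : Bool) :
    σ.Germ d s b p := by
  rw [Rect.mem_toSet σ d] at h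
  exact ⟨.of_mem_Ioo _ h.1.1 h.1.2, .of_mem_Ioo _ h.2.1 h.2.2⟩

/-- The side of a rectangle across the axis `d`: the lower one for `b = true` and the upper one for
`b = false`. Thus the rectangle lies in direction `b` of this side. -/
def Rect.side (σ : Rect) (b : Bool) (d : Dir) : ℝ :=
  if b then σ.lo d else σ.hi d

theorem Rect.inGerm_side (σ : Rect) (b : Bool) (d : Dir) :
    InGerm b (σ.lo d) (σ.hi d) (σ.side b d) := by
  have := σ.lo_lt_hi d
  cases b <;> simp [InGerm, Rect.side, this]

/-- The edge `τ` is part of a side of the rectangle `σ`, which lies in direction `b` of `τ`. -/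
def Rect.IsSide (b : Bool) (σ : Rect) (τ : Edge) : Prop :=
  σ.lo τ.dir ≤ τ.lo ∧ τ.hi ≤ σ.hi τ.dir ∧ τ.pos = σ.side b τ.dir.flip

theorem Rect.IsSide.germ {b s : Bool} {σ : Rect} {τ : Edge} (h : σ.IsSide b τ) {p : ℝ × ℝ}
    (h₁ : τ.dir.flip.coord p = τ.pos) (h₂ : InGerm s τ.lo τ.hi (τ.dir.coord p)) :
    σ.Germ τ.dir s b p :=
  ⟨h₂.mono h.1 h.2.1, by rw [h₁, h.2.2]; exact σ.inGerm_side _ _⟩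

/-! ### Building hierarchical meshes by elementary steps -/

/-- The part of the edge `τ` below `c`. -/
def Edge.left (τ : Edge) (c : ℝ) (h : τ.lo < c) : Edge := ⟨τ.dir, τ.pos, τ.lo, c, h⟩

/-- The part of the edge `τ` above `c`. -/
def Edge.right (τ : Edge) (c : ℝ) (h : c < τ.hi) : Edge := ⟨τ.dir, τ.pos, c, τ.hi, h⟩

/-- Cut the edge `τ`; the new point becomes a vertex. -/
def MeshData.cutEdge (M : MeshData) (τ : Edge) (c : ℝ) (h₁ : τ.lo < c) (h₂ : c < τ.hi) :
    MeshData where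
  faces := M.faces
  edges := insert (τ.left c h₁) (insert (τ.right c h₂) (M.edges.erase τ))
  vertices := insert (τ.dir.point c τ.pos) M.vertices

/-- The edge in direction `d` that splits the rectangle `σ` at the value `t` of the other
coordinate. -/
def Rect.cross (σ : Rect) (d : Dir) (t : ℝ) : Edge := ⟨d, t, σ.lo d, σ.hi d, σ.lo_lt_hi d⟩

/-- Split the face `σ` by an edge in direction `d`, without changing vertices or other edges. -/
def MeshData.splitFace (M : MeshData) (σ : Rect) (d : Dir) (t : ℝ) (h₁ : σ.lo d.flip < t)
    (h₂ : t < σ.hi d.flip) : MeshData where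
  faces := {σ.lower d.flip t h₁, σ.upper d.flip t h₂} ∪ M.faces.erase σ
  edges := insert (σ.cross d t) M.edges
  vertices := M.vertices

/-- Meshes obtained from the rectangle `R` by cutting edges, and by splitting faces between two
points that are already vertices. -/
inductive Built (R : Rect) : MeshData → Prop
  | single : Built R (MeshData.single R)
  | cutEdge (M : MeshData) (τ : Edge) (c : ℝ) (h₁ : τ.lo < c) (h₂ : c < τ.hi) :
      Built R M → τ ∈ M.edges → Built R (M.cutEdge τ c h₁ h₂)
  | splitFace (M : MeshData) (σ : Rect) (d : Dir) (t : ℝ) (h₁ : σ.lo d.flip < t)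
      (h₂ : t < σ.hi d.flip) : Built R M → σ ∈ M.faces → (σ.cross d t).src ∈ M.vertices →
      (σ.cross d t).tgt ∈ M.vertices → Built R (M.splitFace σ d t h₁ h₂)

/-- The geometric properties of a mesh on the rectangle `R` that the homological arguments use.
By `exists_germ` and `germ_unique`, the half-open faces of each of the four kinds tile the half-open
rectangle of this kind; by `cover`, the sides of the faces are covered by half-open edges, so that
an edge leaves each point of a side along this side; `exists_isSide` says that each edge that meets
the interior of the domain has a face on each side. -/
structure IsTiling (R : Rect) (M : MeshData) : Prop where
  face_le : ∀ σ ∈ M.faces, ∀ d, R.lo d ≤ σ.lo d ∧ σ.hi d ≤ R.hi d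
  exists_germ : ∀ d s b p, R.Germ d s b p → ∃ σ ∈ M.faces, σ.Germ d s b p
  germ_unique : ∀ d s b p, ∀ σ ∈ M.faces, ∀ σ' ∈ M.faces, σ.Germ d s b p → σ'.Germ d s b p → σ = σ'
  edge_le : ∀ τ ∈ M.edges, R.lo τ.dir ≤ τ.lo ∧ τ.hi ≤ R.hi τ.dir
  edge_face : ∀ τ ∈ M.edges, ∀ p ∈ τ.toSet, ∀ σ ∈ M.faces, p ∉ σ.toSet
  vertex_face : ∀ γ ∈ M.vertices, ∀ σ ∈ M.faces, γ ∉ σ.toSet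
  src_mem : ∀ τ ∈ M.edges, τ.src ∈ M.vertices
  tgt_mem : ∀ τ ∈ M.edges, τ.tgt ∈ M.vertices
  eq_end : ∀ γ ∈ M.vertices, ∀ τ ∈ M.edges, γ ∈ τ.toSet → γ = τ.src ∨ γ = τ.tgt
  inter_vertex : ∀ τ ∈ M.edges, ∀ τ' ∈ M.edges, τ ≠ τ' → ∀ p ∈ τ.toSet, p ∈ τ'.toSet →
    p ∈ M.vertices
  exists_isSide : ∀ τ ∈ M.edges, ∀ p ∈ τ.toSet, p ∈ R.toSet → ∀ b, ∃ σ ∈ M.faces, σ.IsSide b τ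
  cover : ∀ σ ∈ M.faces, ∀ d b s p, d.flip.coord p = σ.side b d.flip →
    InGerm s (σ.lo d) (σ.hi d) (d.coord p) →
    ∃ τ ∈ M.edges, τ.dir = d ∧ τ.pos = d.flip.coord p ∧ InGerm s τ.lo τ.hi (d.coord p)

theorem mem_single_edges {R : Rect} {τ : Edge} (h : τ ∈ (MeshData.single R).edges) :
    τ.lo = R.lo τ.dir ∧ τ.hi = R.hi τ.dir ∧ ∃ b, τ.pos = R.side b τ.dir.flip := by
  simp only [MeshData.single, Finset.mem_insert, Finset.mem_singleton] at h
  rcases h with rfl | rfl | rfl | rfl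
  · exact ⟨rfl, rfl, true, rfl⟩
  · exact ⟨rfl, rfl, false, rfl⟩
  · exact ⟨rfl, rfl, true, rfl⟩
  · exact ⟨rfl, rfl, false, rfl⟩

theorem mem_single_vertices {R : Rect} {γ : ℝ × ℝ} : γ ∈ (MeshData.single R).vertices ↔
    ∀ d : Dir, ∃ b, d.coord γ = R.side b d := by
  constructor
  · intro h d
    simp only [MeshData.single, Finset.mem_insert, Finset.mem_singleton] at h
    rcases h with rfl | rfl | rfl | rfl <;> cases d <;>
      first | exact ⟨true, rfl⟩ | exact ⟨false, rfl⟩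
  · intro h
    obtain ⟨b, hb⟩ := h .horizontal
    obtain ⟨b', hb'⟩ := h .vertical
    obtain ⟨x, y⟩ := γ
    simp only [Dir.coord] at hb hb'
    subst hb hb'
    cases b <;> cases b' <;> simp [MeshData.single, Rect.side, Rect.lo, Rect.hi]

theorem side_not_mem_Ioo {σ : Rect} {b : Bool} {d : Dir} {x : ℝ} (h : x = σ.side b d) :
    ¬ (σ.lo d < x ∧ x < σ.hi d) := by
  subst h
  cases b <;> simp [Rect.side]

theorem isTiling_single (R : Rect) : IsTiling R (MeshData.single R) where
  face_le := by simp [MeshData.single]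
  exists_germ := by simp [MeshData.single]
  germ_unique := by
    intro d s b p σ hσ σ' hσ' _ _
    simp only [MeshData.single, Finset.mem_singleton] at hσ hσ'
    rw [hσ, hσ']
  edge_le := by
    intro τ hτ
    obtain ⟨h1, h2, -⟩ := mem_single_edges hτ
    exact ⟨h1.ge, h2.le⟩
  edge_face := by
    intro τ hτ p hp σ hσ h
    simp only [MeshData.single, Finset.mem_singleton] at hσ
    subst hσ
    obtain ⟨-, -, b, hb⟩ := mem_single_edges hτ
    rw [Edge.mem_toSet] at hp
    rw [Rect.mem_toSet _ τ.dir] at h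
    exact side_not_mem_Ioo (hp.1.trans hb) h.2
  vertex_face := by
    intro γ hγ σ hσ h
    simp only [MeshData.single, Finset.mem_singleton] at hσ
    subst hσ
    rw [Rect.mem_toSet _ .horizontal] at h
    obtain ⟨b, hb⟩ := mem_single_vertices.mp hγ .horizontal
    exact side_not_mem_Ioo hb h.1
  src_mem := by
    intro τ hτ
    obtain ⟨h1, -, b, hb⟩ := mem_single_edges hτ
    rw [mem_single_vertices]
    intro d
    rcases τ.dir.eq_or_eq_flip d with rfl | rfl
    · exact ⟨true, by simp [Edge.src, Rect.side, h1]⟩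
    · exact ⟨b, by simp [Edge.src, hb]⟩
  tgt_mem := by
    intro τ hτ
    obtain ⟨-, h1, b, hb⟩ := mem_single_edges hτ
    rw [mem_single_vertices]
    intro d
    rcases τ.dir.eq_or_eq_flip d with rfl | rfl
    · exact ⟨false, by simp [Edge.tgt, Rect.side, h1]⟩
    · exact ⟨b, by simp [Edge.tgt, hb]⟩
  eq_end := by
    intro γ hγ τ hτ h
    obtain ⟨h1, h2, -⟩ := mem_single_edges hτ
    obtain ⟨b, hb⟩ := mem_single_vertices.mp hγ τ.dir
    rw [Edge.mem_toSet] at h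
    rw [Edge.eq_src_iff, Edge.eq_tgt_iff, h1, h2, hb]
    cases b <;> simp [Rect.side, h.1]
  inter_vertex := by
    intro τ hτ τ' hτ' hne p hp hp'
    obtain ⟨h1, h2, b, hb⟩ := mem_single_edges hτ
    obtain ⟨h1', h2', b', hb'⟩ := mem_single_edges hτ'
    rw [Edge.mem_toSet] at hp hp'
    rw [mem_single_vertices]
    intro d
    by_cases hd : τ.dir = τ'.dir
    · exfalso
      apply hne
      obtain ⟨d, b, l, h, _⟩ := τ
      obtain ⟨d', b', l', h', _⟩ := τ'
      simp only at hd
      subst hd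
      simp only [Edge.mk.injEq, true_and] at *
      exact ⟨hp.1.symm.trans hp'.1, h1.trans h1'.symm, h2.trans h2'.symm⟩
    · have hd' : τ'.dir = τ.dir.flip := (τ.dir.eq_or_eq_flip τ'.dir).resolve_left (Ne.symm hd)
      rcases τ.dir.eq_or_eq_flip d with rfl | rfl
      · exact ⟨b', by rw [← Dir.flip_flip τ.dir, ← hd', hp'.1, hb']⟩
      · exact ⟨b, by rw [hp.1, hb]⟩
  exists_isSide := by
    intro τ hτ p hp hpR
    exfalso
    obtain ⟨-, -, b, hb⟩ := mem_single_edges hτ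
    rw [Edge.mem_toSet] at hp
    rw [Rect.mem_toSet _ τ.dir] at hpR
    exact side_not_mem_Ioo (hp.1.trans hb) hpR.2
  cover := by
    intro σ hσ d b s p hp hs
    simp only [MeshData.single, Finset.mem_singleton] at hσ
    subst hσ
    refine ⟨⟨d, σ.side b d.flip, σ.lo d, σ.hi d, σ.lo_lt_hi d⟩, ?_, rfl, hp.symm, hs⟩
    cases d <;> cases b <;>
      simp [MeshData.single, Rect.side, Rect.lo, Rect.hi, Dir.flip]

theorem IsTiling.not_mem_vertices {R : Rect} {M : MeshData} (hM : IsTiling R M) {τ : Edge}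
    (hτ : τ ∈ M.edges) {p : ℝ × ℝ} (hp : p ∈ τ.relInterior) : p ∉ M.vertices := fun h =>
  Edge.not_mem_relInterior_of_end (hM.eq_end p h τ hτ (τ.relInterior_subset hp)) hp

/-- Different edges do not meet in relative interior points. -/
theorem IsTiling.eq_of_mem_relInterior {R : Rect} {M : MeshData} (hM : IsTiling R M) {τ τ' : Edge}
    (hτ : τ ∈ M.edges) (hτ' : τ' ∈ M.edges) {p : ℝ × ℝ} (hp : p ∈ τ.relInterior)
    (hp' : p ∈ τ'.toSet) : τ = τ' := by
  by_contra hne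
  exact hM.not_mem_vertices hτ hp (hM.inter_vertex τ hτ τ' hτ' hne p (τ.relInterior_subset hp) hp')

theorem Edge.mem_left {τ : Edge} {c : ℝ} {h : τ.lo < c} (hc : c < τ.hi) {p : ℝ × ℝ}
    (hp : p ∈ (τ.left c h).toSet) : p ∈ τ.toSet ∧ τ.dir.coord p ≤ c := by
  rw [Edge.mem_toSet] at *
  exact ⟨⟨hp.1, hp.2.1, hp.2.2.trans hc.le⟩, hp.2.2⟩

theorem Edge.mem_right {τ : Edge} {c : ℝ} {h : c < τ.hi} (hc : τ.lo < c) {p : ℝ × ℝ}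
    (hp : p ∈ (τ.right c h).toSet) : p ∈ τ.toSet ∧ c ≤ τ.dir.coord p := by
  rw [Edge.mem_toSet] at *
  exact ⟨⟨hp.1, hc.le.trans hp.2.1, hp.2.2⟩, hp.2.1⟩

theorem IsTiling.cutEdge {R : Rect} {M : MeshData} (hM : IsTiling R M) {τ : Edge}
    (hτ : τ ∈ M.edges) {c : ℝ} (h₁ : τ.lo < c) (h₂ : c < τ.hi) :
    IsTiling R (M.cutEdge τ c h₁ h₂) := by
  have hcut : ∀ τ' ∈ (M.cutEdge τ c h₁ h₂).edges,
      τ' = τ.left c h₁ ∨ τ' = τ.right c h₂ ∨ τ' ∈ M.edges ∧ τ' ≠ τ := by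
    intro τ' h
    simp only [MeshData.cutEdge, Finset.mem_insert, Finset.mem_erase] at h
    tauto
  have hint : τ.dir.point c τ.pos ∈ τ.relInterior := ⟨c, ⟨h₁, h₂⟩, rfl⟩
  -- Each edge of the new mesh is part of an edge of the old one.
  have hpar : ∀ τ' ∈ (M.cutEdge τ c h₁ h₂).edges, ∃ τ₀ ∈ M.edges, τ₀.dir = τ'.dir ∧
      τ₀.pos = τ'.pos ∧ τ₀.lo ≤ τ'.lo ∧ τ'.hi ≤ τ₀.hi ∧ τ'.toSet ⊆ τ₀.toSet := by
    intro τ' h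
    rcases hcut τ' h with rfl | rfl | h
    · exact ⟨τ, hτ, rfl, rfl, le_rfl, h₂.le, fun p hp => (Edge.mem_left h₂ hp).1⟩
    · exact ⟨τ, hτ, rfl, rfl, h₁.le, le_rfl, fun p hp => (Edge.mem_right h₁ hp).1⟩
    · exact ⟨τ', h.1, rfl, rfl, le_rfl, le_rfl, subset_rfl⟩
  refine ⟨hM.face_le, hM.exists_germ, hM.germ_unique, ?_, ?_, ?_, ?_, ?_, ?_, ?_, ?_, ?_⟩
  · intro τ' h
    obtain ⟨τ₀, h0, hd, -, hl, hh, -⟩ := hpar τ' h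
    rw [← hd]
    exact ⟨(hM.edge_le τ₀ h0).1.trans hl, hh.trans (hM.edge_le τ₀ h0).2⟩
  · intro τ' h p hp
    obtain ⟨τ₀, h0, -, -, -, -, hs⟩ := hpar τ' h
    exact hM.edge_face τ₀ h0 p (hs hp)
  · intro γ hγ
    rcases Finset.mem_insert.mp hγ with rfl | hγ
    · exact hM.edge_face τ hτ _ (τ.relInterior_subset hint)
    · exact hM.vertex_face γ hγ
  · intro τ' h
    rcases hcut τ' h with rfl | rfl | h
    · exact Finset.mem_insert_of_mem (hM.src_mem τ hτ)
    · exact Finset.mem_insert_self _ _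
    · exact Finset.mem_insert_of_mem (hM.src_mem τ' h.1)
  · intro τ' h
    rcases hcut τ' h with rfl | rfl | h
    · exact Finset.mem_insert_self _ _
    · exact Finset.mem_insert_of_mem (hM.tgt_mem τ hτ)
    · exact Finset.mem_insert_of_mem (hM.tgt_mem τ' h.1)
  · intro γ hγ τ' h hγτ
    rcases hcut τ' h with rfl | rfl | h
    · obtain ⟨h3, h4⟩ := Edge.mem_left h₂ hγτ
      rcases Finset.mem_insert.mp hγ with rfl | hγ
      · exact Or.inr rfl
      · rcases hM.eq_end γ hγ τ hτ h3 with h5 | h5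
        · exact Or.inl h5
        · rw [Edge.eq_tgt_iff] at h5
          linarith [h5.1]
    · obtain ⟨h3, h4⟩ := Edge.mem_right h₁ hγτ
      rcases Finset.mem_insert.mp hγ with rfl | hγ
      · exact Or.inl rfl
      · rcases hM.eq_end γ hγ τ hτ h3 with h5 | h5
        · rw [Edge.eq_src_iff] at h5
          linarith [h5.1]
        · exact Or.inr h5
    · rcases Finset.mem_insert.mp hγ with rfl | hγ
      · exact absurd (hM.eq_of_mem_relInterior hτ h.1 hint hγτ).symm h.2
      · exact hM.eq_end γ hγ τ' h.1 hγτ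
  · have hlr : ∀ p, p ∈ (τ.left c h₁).toSet → p ∈ (τ.right c h₂).toSet →
        p ∈ (M.cutEdge τ c h₁ h₂).vertices := by
      intro p hp hp'
      have h3 := Edge.mem_left h₂ hp
      have h4 := Edge.mem_right h₁ hp'
      refine Finset.mem_insert.mpr (Or.inl ?_)
      rw [Dir.eq_point_iff]
      exact ⟨le_antisymm h3.2 h4.2, ((Edge.mem_toSet _ _).mp h3.1).1⟩
    have hold : ∀ τ' ∈ M.edges, ∀ τ'' ∈ M.edges, τ' ≠ τ'' → ∀ p ∈ τ'.toSet, p ∈ τ''.toSet →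
        p ∈ (M.cutEdge τ c h₁ h₂).vertices := fun τ' h' τ'' h'' hne p hp hp' =>
      Finset.mem_insert_of_mem (hM.inter_vertex τ' h' τ'' h'' hne p hp hp')
    intro τ' h' τ'' h'' hne p hp hp'
    rcases hcut τ' h' with rfl | rfl | h' <;> rcases hcut τ'' h'' with rfl | rfl | h''
    · exact absurd rfl hne
    · exact hlr p hp hp'
    · exact hold τ hτ τ'' h''.1 h''.2.symm p (Edge.mem_left h₂ hp).1 hp'
    · exact hlr p hp' hp
    · exact absurd rfl hne
    · exact hold τ hτ τ'' h''.1 h''.2.symm p (Edge.mem_right h₁ hp).1 hp'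
    · exact hold τ' h'.1 τ hτ h'.2 p hp (Edge.mem_left h₂ hp').1
    · exact hold τ' h'.1 τ hτ h'.2 p hp (Edge.mem_right h₁ hp').1
    · exact hold τ' h'.1 τ'' h''.1 hne p hp hp'
  · intro τ' h' p hp hpR b
    obtain ⟨τ₀, h0, hd, hpos, hl, hh, hs⟩ := hpar τ' h'
    obtain ⟨σ, hσ, h3⟩ := hM.exists_isSide τ₀ h0 p (hs hp) hpR b
    rw [Rect.IsSide, hd, hpos] at h3
    exact ⟨σ, hσ, h3.1.trans hl, hh.trans h3.2.1, h3.2.2⟩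
  · intro σ hσ d b s p hp hs
    obtain ⟨τ₀, h0, hd, hpos, hg⟩ := hM.cover σ hσ d b s p hp hs
    by_cases h3 : τ₀ = τ
    · subst h3
      rcases hg.split c with hg | hg
      · exact ⟨τ₀.left c h₁, by simp [MeshData.cutEdge], hd, hpos, hg⟩
      · exact ⟨τ₀.right c h₂, by simp [MeshData.cutEdge], hd, hpos, hg⟩
    · exact ⟨τ₀, by simp [MeshData.cutEdge, h3, h0], hd, hpos, hg⟩

theorem IsTiling.splitFace {R : Rect} {M : MeshData} (hM : IsTiling R M) {σ : Rect}
    (hσ : σ ∈ M.faces) {d : Dir} {t : ℝ} (h₁ : σ.lo d.flip < t) (h₂ : t < σ.hi d.flip)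
    (hsrc : (σ.cross d t).src ∈ M.vertices) (htgt : (σ.cross d t).tgt ∈ M.vertices) :
    IsTiling R (M.splitFace σ d t h₁ h₂) := by
  have hface : ∀ σ' ∈ (M.splitFace σ d t h₁ h₂).faces, σ' = σ.lower d.flip t h₁ ∨
      σ' = σ.upper d.flip t h₂ ∨ σ' ∈ M.faces ∧ σ' ≠ σ := by
    intro σ' h
    simp only [MeshData.splitFace, Finset.mem_union, Finset.mem_insert, Finset.mem_singleton,
      Finset.mem_erase] at h
    tauto
  have hlow : σ.lower d.flip t h₁ ∈ (M.splitFace σ d t h₁ h₂).faces := by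
    simp [MeshData.splitFace]
  have hupp : σ.upper d.flip t h₂ ∈ (M.splitFace σ d t h₁ h₂).faces := by
    simp [MeshData.splitFace]
  have hold : ∀ σ' ∈ M.faces, σ' ≠ σ → σ' ∈ (M.splitFace σ d t h₁ h₂).faces := by
    intro σ' h h'
    simp [MeshData.splitFace, h, h']
  have hedge : ∀ τ ∈ (M.splitFace σ d t h₁ h₂).edges, τ = σ.cross d t ∨ τ ∈ M.edges :=
    fun τ h => Finset.mem_insert.mp h
  have hd : ∀ d' : Dir, d' = d ∨ d' = d.flip := d.eq_or_eq_flip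
  have hl0 := (σ.lower_lo d.flip t h₁)
  have hl1 := (σ.lower_hi d.flip t h₁)
  have hl2 := (σ.lower_hi_flip d.flip t h₁)
  have hu0 := (σ.upper_hi d.flip t h₂)
  have hu1 := (σ.upper_lo d.flip t h₂)
  have hu2 := (σ.upper_lo_flip d.flip t h₂)
  rw [Dir.flip_flip] at hl2 hu2
  have hlowle := σ.lower_le d.flip h₁ h₂.le
  have huple := σ.upper_le d.flip h₁.le h₂
  -- Each face of the new mesh is part of a face of the old one.
  have hpar : ∀ σ' ∈ (M.splitFace σ d t h₁ h₂).faces, ∃ σ₀ ∈ M.faces,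
      ∀ d', σ₀.lo d' ≤ σ'.lo d' ∧ σ'.hi d' ≤ σ₀.hi d' := by
    intro σ' h
    rcases hface σ' h with rfl | rfl | h
    · exact ⟨σ, hσ, hlowle⟩
    · exact ⟨σ, hσ, huple⟩
    · exact ⟨σ', h.1, fun d' => ⟨le_rfl, le_rfl⟩⟩
  have hparset : ∀ σ' ∈ (M.splitFace σ d t h₁ h₂).faces, ∃ σ₀ ∈ M.faces,
      ∀ p, p ∈ σ'.toSet → p ∈ σ₀.toSet := by
    intro σ' h
    obtain ⟨σ₀, h0, hle⟩ := hpar σ' h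
    refine ⟨σ₀, h0, fun p hp => ?_⟩
    rw [Rect.mem_toSet _ d] at *
    exact ⟨⟨(hle _).1.trans_lt hp.1.1, hp.1.2.trans_le (hle _).2⟩,
      ⟨(hle _).1.trans_lt hp.2.1, hp.2.2.trans_le (hle _).2⟩⟩
  have hsplit : ∀ {s b p}, σ.Germ d s b p →
      (σ.lower d.flip t h₁).Germ d s b p ∨ (σ.upper d.flip t h₂).Germ d s b p := by
    intro s b p hg
    simp only [Rect.Germ, hl0, hl1, hl2, hu0, hu1, hu2]
    rcases hg.2.split t with h | h
    · exact Or.inl ⟨hg.1, h⟩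
    · exact Or.inr ⟨hg.1, h⟩
  have hdisj : ∀ {s b p}, (σ.lower d.flip t h₁).Germ d s b p →
      (σ.upper d.flip t h₂).Germ d s b p → False := by
    intro s b p h h'
    simp only [Rect.Germ, hl0, hl1, hl2, hu0, hu1, hu2] at h h'
    exact h.2.disjoint h'.2
  have hrel : ∀ p, p ∈ (σ.cross d t).relInterior → p ∈ σ.toSet := by
    intro p hp
    rw [Edge.mem_relInterior] at hp
    simp only [Rect.cross] at hp
    rw [Rect.mem_toSet _ d, hp.1]
    exact ⟨hp.2, h₁, h₂⟩
  have hexists : ∀ s b p, R.Germ d s b p →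
      ∃ σ' ∈ (M.splitFace σ d t h₁ h₂).faces, σ'.Germ d s b p := by
    intro s b p hp
    obtain ⟨σ', hσ', hg⟩ := hM.exists_germ d s b p hp
    by_cases h : σ' = σ
    · subst h
      rcases hsplit hg with h | h
      · exact ⟨_, hlow, h⟩
      · exact ⟨_, hupp, h⟩
    · exact ⟨σ', hold σ' hσ' h, hg⟩
  have hunique : ∀ s b p, ∀ σ' ∈ (M.splitFace σ d t h₁ h₂).faces,
      ∀ σ'' ∈ (M.splitFace σ d t h₁ h₂).faces, σ'.Germ d s b p → σ''.Germ d s b p →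
      σ' = σ'' := by
    intro s b p σ' hσ' σ'' hσ'' hg' hg''
    have hσ0 : σ.lower d.flip t h₁ = σ' ∨ σ.upper d.flip t h₂ = σ' → σ.Germ d s b p := by
      rintro (rfl | rfl)
      · exact hg'.mono hlowle
      · exact hg'.mono huple
    have hσ1 : σ.lower d.flip t h₁ = σ'' ∨ σ.upper d.flip t h₂ = σ'' → σ.Germ d s b p := by
      rintro (rfl | rfl)
      · exact hg''.mono hlowle
      · exact hg''.mono huple
    rcases hface σ' hσ' with h' | h' | h' <;> rcases hface σ'' hσ'' with h'' | h'' | h''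
    · rw [h', h'']
    · subst h' h''; exact (hdisj hg' hg'').elim
    · exact absurd (hM.germ_unique d s b p _ h''.1 _ hσ hg'' (hσ0 (Or.inl h'.symm))) h''.2
    · subst h' h''; exact (hdisj hg'' hg').elim
    · rw [h', h'']
    · exact absurd (hM.germ_unique d s b p _ h''.1 _ hσ hg'' (hσ0 (Or.inr h'.symm))) h''.2
    · exact absurd (hM.germ_unique d s b p _ h'.1 _ hσ hg' (hσ1 (Or.inl h''.symm))) h'.2
    · exact absurd (hM.germ_unique d s b p _ h'.1 _ hσ hg' (hσ1 (Or.inr h''.symm))) h'.2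
    · exact hM.germ_unique d s b p _ h'.1 _ h''.1 hg' hg''
  refine ⟨?_, ?_, ?_, ?_, ?_, ?_, ?_, ?_, ?_, ?_, ?_, ?_⟩
  · intro σ' h d'
    obtain ⟨σ₀, h0, hle⟩ := hpar σ' h
    exact ⟨(hM.face_le σ₀ h0 d').1.trans (hle d').1, (hle d').2.trans (hM.face_le σ₀ h0 d').2⟩
  · intro d' s b p hp
    rcases hd d' with rfl | rfl
    · exact hexists s b p hp
    · simp only [Rect.germ_flip] at hp ⊢
      exact hexists b s p hp
  · intro d' s b p
    rcases hd d' with rfl | rfl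
    · exact hunique s b p
    · simp only [Rect.germ_flip]
      exact hunique b s p
  · intro τ hτ
    rcases hedge τ hτ with rfl | hτ
    · exact hM.face_le σ hσ d
    · exact hM.edge_le τ hτ
  · intro τ hτ p hp σ' hσ' h
    rcases hedge τ hτ with rfl | hτ
    · rcases Edge.mem_toSet_cases hp with h3 | h3
      · rcases hface σ' hσ' with rfl | rfl | h4
        · rw [Rect.mem_toSet _ d, hl1] at h
          have h5 := ((Edge.mem_relInterior _ _).mp h3).1
          simp only [Rect.cross] at h5
          linarith [h.2.2]
        · rw [Rect.mem_toSet _ d, hu1] at h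
          have h5 := ((Edge.mem_relInterior _ _).mp h3).1
          simp only [Rect.cross] at h5
          linarith [h.2.1]
        · exact h4.2 (hM.germ_unique d true true p _ h4.1 _ hσ (Rect.germ_of_mem h _ _ _)
            (Rect.germ_of_mem (hrel p h3) _ _ _))
      · obtain ⟨σ₀, h0, hs⟩ := hparset σ' hσ'
        have : p ∈ M.vertices := by rcases h3 with rfl | rfl <;> assumption
        exact hM.vertex_face p this σ₀ h0 (hs p h)
    · obtain ⟨σ₀, h0, hs⟩ := hparset σ' hσ'
      exact hM.edge_face τ hτ p hp σ₀ h0 (hs p h)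
  · intro γ hγ σ' hσ' h
    obtain ⟨σ₀, h0, hs⟩ := hparset σ' hσ'
    exact hM.vertex_face γ hγ σ₀ h0 (hs γ h)
  · intro τ hτ
    rcases hedge τ hτ with rfl | hτ
    · exact hsrc
    · exact hM.src_mem τ hτ
  · intro τ hτ
    rcases hedge τ hτ with rfl | hτ
    · exact htgt
    · exact hM.tgt_mem τ hτ
  · intro γ hγ τ hτ h
    rcases hedge τ hτ with rfl | hτ
    · exact (Edge.mem_toSet_cases h).resolve_left
        fun h3 => hM.vertex_face γ hγ σ hσ (hrel γ h3)
    · exact hM.eq_end γ hγ τ hτ h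
  · have hnew : ∀ τ ∈ M.edges, ∀ p ∈ τ.toSet, p ∈ (σ.cross d t).toSet → p ∈ M.vertices := by
      intro τ hτ p hp hp'
      rcases Edge.mem_toSet_cases hp' with h3 | rfl | rfl
      · exact absurd (hrel p h3) (hM.edge_face τ hτ p hp σ hσ)
      · exact hsrc
      · exact htgt
    intro τ hτ τ' hτ' hne p hp hp'
    rcases hedge τ hτ with rfl | hτ <;> rcases hedge τ' hτ' with rfl | hτ'
    · exact absurd rfl hne
    · exact hnew τ' hτ' p hp' hp
    · exact hnew τ hτ p hp hp'
    · exact hM.inter_vertex τ hτ τ' hτ' hne p hp hp'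
  · intro τ hτ p hp hpR b
    rcases hedge τ hτ with rfl | hτM
    · cases b
      · exact ⟨_, hlow, by simp [Rect.cross, hl0], by simp [Rect.cross, hl2],
          by simp [Rect.cross, Rect.side, hl1]⟩
      · exact ⟨_, hupp, by simp [Rect.cross, hu2], by simp [Rect.cross, hu0],
          by simp [Rect.cross, Rect.side, hu1]⟩
    · obtain ⟨σ', hσ', h⟩ := hM.exists_isSide τ hτM p hp hpR b
      by_cases h3 : σ' = σ
      · subst h3
        obtain ⟨ha, hb, hc⟩ := h
        rcases hd τ.dir with hτd | hτd
        · rw [hτd] at ha hb hc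
          cases b
          · refine ⟨_, hupp, ?_⟩
            rw [Rect.IsSide, hτd, hu0, hu2]
            exact ⟨ha, hb, by simp [hc, Rect.side]⟩
          · refine ⟨_, hlow, ?_⟩
            rw [Rect.IsSide, hτd, hl0, hl2]
            exact ⟨ha, hb, by simp [hc, Rect.side]⟩
        · rw [hτd] at ha hb hc
          rw [Dir.flip_flip] at hc
          -- The new vertex on this side of the split face does not lie inside `τ`.
          have hcut : t ≤ τ.lo ∨ τ.hi ≤ t := by
            by_contra hcon
            push Not at hcon
            have hv : d.point (σ'.side b d) t ∈ M.vertices := by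
              cases b
              · exact htgt
              · exact hsrc
            refine hM.not_mem_vertices hτM ?_ hv
            rw [Edge.mem_relInterior, hτd]
            simpa [hc] using hcon
          rcases hcut with hcut | hcut
          · refine ⟨_, hupp, ?_⟩
            rw [Rect.IsSide, hτd, hu0, hu1]
            refine ⟨hcut, hb, ?_⟩
            rw [hc, Dir.flip_flip]
            simp [Rect.side, hu0, hu2]
          · refine ⟨_, hlow, ?_⟩
            rw [Rect.IsSide, hτd, hl0, hl1]
            refine ⟨ha, hcut, ?_⟩
            rw [hc, Dir.flip_flip]
            simp [Rect.side, hl0, hl2]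
      · exact ⟨σ', hold σ' hσ' h3, h⟩
  · intro σ' hσ' d' b s p hp hs
    have hcov : ∀ σ₀ ∈ M.faces, d'.flip.coord p = σ₀.side b d'.flip →
        InGerm s (σ₀.lo d') (σ₀.hi d') (d'.coord p) →
        ∃ τ ∈ (M.splitFace σ d t h₁ h₂).edges, τ.dir = d' ∧ τ.pos = d'.flip.coord p ∧
          InGerm s τ.lo τ.hi (d'.coord p) := by
      intro σ₀ h0 hp hs
      obtain ⟨τ, hτ, h⟩ := hM.cover σ₀ h0 d' b s p hp hs
      exact ⟨τ, Finset.mem_insert_of_mem hτ, h⟩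
    have hcross : d' = d → d.flip.coord p = t → InGerm s (σ.lo d) (σ.hi d) (d.coord p) →
        ∃ τ ∈ (M.splitFace σ d t h₁ h₂).edges, τ.dir = d' ∧ τ.pos = d'.flip.coord p ∧
          InGerm s τ.lo τ.hi (d'.coord p) := by
      rintro rfl hp hs
      exact ⟨_, Finset.mem_insert_self _ _, rfl, hp.symm, hs⟩
    rcases hface σ' hσ' with rfl | rfl | h
    · rcases hd d' with rfl | rfl
      · rw [hl0, hl2] at hs
        cases b
        · exact hcross rfl (by simpa [Rect.side, hl1] using hp) hs
        · exact hcov σ hσ (by simpa [Rect.side] using hp) hs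
      · rw [hl0, hl1] at hs
        exact hcov σ hσ (by simpa [Rect.side, hl2] using hp) (hs.mono le_rfl h₂.le)
    · rcases hd d' with rfl | rfl
      · rw [hu0, hu2] at hs
        cases b
        · exact hcov σ hσ (by simpa [Rect.side] using hp) hs
        · exact hcross rfl (by simpa [Rect.side, hu1] using hp) hs
      · rw [hu0, hu1] at hs
        exact hcov σ hσ (by simpa [Rect.side, hu2] using hp) (hs.mono h₁.le le_rfl)
    · exact hcov σ' h.1 hp hs

theorem Built.isTiling {R : Rect} {M : MeshData} (h : Built R M) : IsTiling R M := by
  induction h with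
  | single => exact isTiling_single R
  | cutEdge M τ c h₁ h₂ _ hτ ih => exact ih.cutEdge hτ h₁ h₂
  | splitFace M σ d t h₁ h₂ _ hσ hs ht ih => exact ih.splitFace hσ h₁ h₂ hs ht

end

section

/-! ### Hierarchical meshes are built by elementary steps -/

/-- Cut all edges at the point `p`, which becomes a vertex. -/
def MeshData.cutPoint (M : MeshData) (p : ℝ × ℝ) : MeshData where
  faces := M.faces
  edges := M.edges.biUnion (Edge.cutAt p)
  vertices := insert p M.vertices

theorem Edge.cutAt_of_not_mem {p : ℝ × ℝ} {τ : Edge} (h : p ∉ τ.relInterior) :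
    τ.cutAt p = {τ} := by
  rw [Edge.cutAt, dif_neg fun h' => h h'.1]

theorem Edge.along_eq (τ : Edge) (p : ℝ × ℝ) : τ.along p = τ.dir.coord p := by
  unfold Edge.along
  cases τ.dir <;> rfl

theorem Edge.cutAt_point (τ : Edge) {c : ℝ} (h₁ : τ.lo < c) (h₂ : c < τ.hi) :
    τ.cutAt (τ.dir.point c τ.pos) = {τ.left c h₁, τ.right c h₂} := by
  have ha : τ.along (τ.dir.point c τ.pos) = c := by simp [Edge.along_eq]
  have h : τ.dir.point c τ.pos ∈ τ.relInterior ∧ τ.lo < τ.along (τ.dir.point c τ.pos) ∧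
      τ.along (τ.dir.point c τ.pos) < τ.hi := by
    rw [ha]
    exact ⟨⟨c, ⟨h₁, h₂⟩, rfl⟩, h₁, h₂⟩
  rw [Edge.cutAt, dif_pos h]
  simp only [Edge.left, Edge.right, ha]

theorem IsTiling.cutPoint_of_mem {R : Rect} {M : MeshData} (hM : IsTiling R M) {p : ℝ × ℝ}
    (hp : p ∈ M.vertices) : M.cutPoint p = M := by
  have h : M.edges.biUnion (Edge.cutAt p) = M.edges := by
    rw [Finset.biUnion_congr rfl fun τ hτ =>
      Edge.cutAt_of_not_mem fun h => hM.not_mem_vertices hτ h hp]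
    exact Finset.biUnion_singleton_eq_self
  rw [MeshData.cutPoint, h, Finset.insert_eq_of_mem hp]

theorem IsTiling.cutPoint_of_mem_relInterior {R : Rect} {M : MeshData} (hM : IsTiling R M)
    {τ : Edge} (hτ : τ ∈ M.edges) {c : ℝ} (h₁ : τ.lo < c) (h₂ : c < τ.hi) :
    M.cutPoint (τ.dir.point c τ.pos) = M.cutEdge τ c h₁ h₂ := by
  have h : M.edges.biUnion (Edge.cutAt (τ.dir.point c τ.pos)) = (M.cutEdge τ c h₁ h₂).edges := by
    conv_lhs => rw [← Finset.insert_erase hτ]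
    rw [Finset.biUnion_insert, Edge.cutAt_point τ h₁ h₂, Finset.biUnion_congr rfl fun τ' hτ' =>
      Edge.cutAt_of_not_mem fun h => (Finset.mem_erase.mp hτ').1
        (hM.eq_of_mem_relInterior (Finset.mem_erase.mp hτ').2 hτ h
          (τ.relInterior_subset ⟨c, ⟨h₁, h₂⟩, rfl⟩)), Finset.biUnion_singleton_eq_self]
    ext
    simp [MeshData.cutEdge]
  rw [MeshData.cutPoint, h]
  rfl

/-- The point `γ` is an end point of edges in both directions. -/
def MeshData.IsCorner (M : MeshData) (γ : ℝ × ℝ) : Prop :=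
  ∀ d, ∃ τ ∈ M.edges, τ.dir = d ∧ (γ = τ.src ∨ γ = τ.tgt)

theorem MeshData.IsCorner.cutEdge {M : MeshData} {γ : ℝ × ℝ} (h : M.IsCorner γ) (τ : Edge) {c : ℝ}
    (h₁ : τ.lo < c) (h₂ : c < τ.hi) : (M.cutEdge τ c h₁ h₂).IsCorner γ := by
  intro d
  obtain ⟨τ', hτ', hd, he⟩ := h d
  by_cases h3 : τ' = τ
  · subst h3
    rcases he with he | he
    · exact ⟨τ'.left c h₁, by simp [MeshData.cutEdge], hd, Or.inl he⟩
    · exact ⟨τ'.right c h₂, by simp [MeshData.cutEdge], hd, Or.inr he⟩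
  · exact ⟨τ', by simp [MeshData.cutEdge, h3, hτ'], hd, he⟩

/-- Cutting at a point of a side of a face is an elementary step or does not change the mesh. -/
theorem Built.cutPoint {R : Rect} {M : MeshData} (hM : Built R M) {σ : Rect} (hσ : σ ∈ M.faces)
    (d : Dir) (b : Bool) {p : ℝ × ℝ} (hp : d.flip.coord p = σ.side b d.flip)
    (hp' : σ.lo d < d.coord p ∧ d.coord p < σ.hi d) :
    Built R (M.cutPoint p) ∧ ∀ γ, M.IsCorner γ → (M.cutPoint p).IsCorner γ := by
  by_cases hv : p ∈ M.vertices
  · rw [hM.isTiling.cutPoint_of_mem hv]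
    exact ⟨hM, fun _ h => h⟩
  · obtain ⟨τ, hτ, rfl, hpos, hg⟩ := hM.isTiling.cover σ hσ d b true p hp
      (.of_mem_Ioo _ hp'.1 hp'.2)
    have hpe : p = τ.dir.point (τ.dir.coord p) τ.pos := (Dir.eq_point_iff _ _ _ _).mpr
      ⟨rfl, hpos.symm⟩
    have h₁ : τ.lo < τ.dir.coord p := by
      refine lt_of_le_of_ne hg.1 fun h => hv ?_
      rw [show p = τ.src from (τ.eq_src_iff p).mpr ⟨h.symm, hpos.symm⟩]
      exact hM.isTiling.src_mem τ hτ
    rw [hpe, hM.isTiling.cutPoint_of_mem_relInterior hτ h₁ hg.2]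
    exact ⟨.cutEdge M τ _ h₁ hg.2 hM hτ, fun γ h => h.cutEdge τ h₁ hg.2⟩

/-- Splitting a face, after cutting the edges at the two ends of the splitting line. -/
theorem Built.cutPoint_splitFace {R : Rect} {M : MeshData} (hM : Built R M) {σ : Rect}
    (hσ : σ ∈ M.faces) (d : Dir) (t : ℝ) (h₁ : σ.lo d.flip < t) (h₂ : t < σ.hi d.flip)
    (hc : ∀ γ ∈ M.vertices, γ ∈ R.toSet → M.IsCorner γ) :
    Built R (((M.cutPoint (σ.cross d t).src).cutPoint (σ.cross d t).tgt).splitFace σ d t h₁ h₂) ∧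
    ∀ γ ∈ insert (σ.cross d t).tgt (insert (σ.cross d t).src M.vertices), γ ∈ R.toSet →
      (((M.cutPoint (σ.cross d t).src).cutPoint (σ.cross d t).tgt).splitFace
        σ d t h₁ h₂).IsCorner γ := by
  obtain ⟨hB1, hc1⟩ := hM.cutPoint hσ d.flip true (p := (σ.cross d t).src)
    (by simp [Rect.cross, Edge.src, Rect.side]) (by simp [Rect.cross, Edge.src, h₁, h₂])
  obtain ⟨hB2, hc2⟩ := hB1.cutPoint (σ := σ) hσ d.flip false (p := (σ.cross d t).tgt)
    (by simp [Rect.cross, Edge.tgt, Rect.side]) (by simp [Rect.cross, Edge.tgt, h₁, h₂])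
  set M₂ := (M.cutPoint (σ.cross d t).src).cutPoint (σ.cross d t).tgt with hM₂
  have hs : (σ.cross d t).src ∈ M₂.vertices := by simp [hM₂, MeshData.cutPoint]
  have ht : (σ.cross d t).tgt ∈ M₂.vertices := by simp [hM₂, MeshData.cutPoint]
  -- At the two ends of the new edge there are edges that cover the sides of the split face.
  have hnew : ∀ γ ∈ M₂.vertices, (γ = (σ.cross d t).src ∨ γ = (σ.cross d t).tgt) →
      (∃ b, d.coord γ = σ.side b d) → d.flip.coord γ = t →
      (M₂.splitFace σ d t h₁ h₂).IsCorner γ := by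
    rintro γ hγ he ⟨b, hb⟩ hγt d'
    rcases d.eq_or_eq_flip d' with rfl | rfl
    · exact ⟨_, Finset.mem_insert_self _ _, rfl, he⟩
    · obtain ⟨τ, hτ, hd, hpos, hg⟩ := hB2.isTiling.cover σ hσ d.flip b true γ (by simpa using hb)
        (.of_mem_Ioo _ (by rw [hγt]; exact h₁) (by rw [hγt]; exact h₂))
      refine ⟨τ, Finset.mem_insert_of_mem hτ, hd, hB2.isTiling.eq_end γ hγ τ hτ ?_⟩
      rw [Edge.mem_toSet, hd]
      exact ⟨hpos.symm, hg.mem_Icc⟩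
  refine ⟨.splitFace _ σ d t h₁ h₂ hB2 hσ hs ht, fun γ hγ hγR => ?_⟩
  rcases Finset.mem_insert.mp hγ with rfl | hγ
  · exact hnew _ ht (Or.inr rfl) ⟨false, by simp [Edge.tgt, Rect.cross, Rect.side]⟩
      (by simp [Edge.tgt, Rect.cross])
  rcases Finset.mem_insert.mp hγ with rfl | hγ
  · exact hnew _ hs (Or.inl rfl) ⟨true, by simp [Edge.src, Rect.cross, Rect.side]⟩
      (by simp [Edge.src, Rect.cross])
  · intro d'
    obtain ⟨τ, hτ, h⟩ := hc2 γ (hc1 γ (hc γ hγ hγR)) d'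
    exact ⟨τ, Finset.mem_insert_of_mem hτ, h⟩

theorem MeshData.IsHierarchical.exists_built {M : MeshData} (h : M.IsHierarchical) :
    ∃ R, Built R M ∧ ∀ γ ∈ M.vertices, γ ∈ R.toSet → M.IsCorner γ := by
  have hV : ∀ (p q : ℝ × ℝ) (V : Finset (ℝ × ℝ)), {p, q} ∪ V = insert q (insert p V) := by
    intro p q V
    ext
    simp only [Finset.mem_union, Finset.mem_insert, Finset.mem_singleton]
    tauto
  induction h with
  | single R =>
    refine ⟨R, .single, fun γ hγ hγR => ?_⟩
    exfalso
    rw [Rect.mem_toSet _ .horizontal] at hγR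
    obtain ⟨b, hb⟩ := mem_single_vertices.mp hγ .horizontal
    exact side_not_mem_Ioo hb hγR.1
  | splitHorizontal M σ t h₁ h₂ _ hσ ih =>
    obtain ⟨R, hB, hc⟩ := ih
    obtain ⟨h3, h4⟩ := hB.cutPoint_splitFace hσ .horizontal t h₁ h₂ hc
    have he : M.splitHorizontal σ t h₁ h₂ =
        ((M.cutPoint (σ.cross .horizontal t).src).cutPoint
          (σ.cross .horizontal t).tgt).splitFace σ .horizontal t h₁ h₂ := by
      rw [MeshData.splitHorizontal, hV]
      rfl
    rw [he]
    exact ⟨R, h3, h4⟩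
  | splitVertical M σ t h₁ h₂ _ hσ ih =>
    obtain ⟨R, hB, hc⟩ := ih
    obtain ⟨h3, h4⟩ := hB.cutPoint_splitFace hσ .vertical t h₁ h₂ hc
    have he : M.splitVertical σ t h₁ h₂ =
        ((M.cutPoint (σ.cross .vertical t).src).cutPoint
          (σ.cross .vertical t).tgt).splitFace σ .vertical t h₁ h₂ := by
      rw [MeshData.splitVertical, hV]
      rfl
    rw [he]
    exact ⟨R, h3, h4⟩

theorem IsTiling.domain_eq {R : Rect} {M : MeshData} (hM : IsTiling R M) :
    M.domain = closure R.toSet := by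
  have hmem : ∀ (σ : Rect) (p : ℝ × ℝ), p ∈ closure σ.toSet ↔
      ∀ d : Dir, σ.lo d ≤ d.coord p ∧ d.coord p ≤ σ.hi d := by
    intro σ p
    rw [Rect.closure_toSet]
    constructor
    · rintro ⟨h1, h2⟩ d
      cases d
      · exact h1
      · exact h2
    · exact fun h => ⟨h .horizontal, h .vertical⟩
  ext p
  simp only [MeshData.domain, Set.mem_iUnion, hmem, exists_prop]
  constructor
  · rintro ⟨σ, hσ, h⟩ d
    exact ⟨(hM.face_le σ hσ d).1.trans (h d).1, (h d).2.trans (hM.face_le σ hσ d).2⟩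
  · intro h
    have hg : ∀ d, ∃ s, InGerm s (R.lo d) (R.hi d) (d.coord p) := by
      intro d
      rcases (h d).2.lt_or_eq with h1 | h1
      · exact ⟨true, (h d).1, h1⟩
      · exact ⟨false, h1 ▸ R.lo_lt_hi d, h1.le⟩
    obtain ⟨s, hs⟩ := hg .horizontal
    obtain ⟨b, hb⟩ := hg .vertical
    obtain ⟨σ, hσ, h3⟩ := hM.exists_germ .horizontal s b p ⟨hs, hb⟩
    refine ⟨σ, hσ, fun d => ?_⟩
    cases d
    · exact h3.1.mem_Icc
    · exact h3.2.mem_Icc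

theorem IsTiling.interior_domain {R : Rect} {M : MeshData} (hM : IsTiling R M) :
    interior M.domain = R.toSet := by
  rw [hM.domain_eq, Rect.interior_closure_toSet]

end

section

/-! ### The boundary map on edges -/

variable {V : Type*} [AddCommGroup V] [Module ℝ V]

/-- The coefficient of the point `p` in the boundary of the edge `τ`. -/
def Edge.incidence (τ : Edge) (p : ℝ × ℝ) : ℝ :=
  (if p = τ.tgt then 1 else 0) - (if p = τ.src then 1 else 0)

/-- The boundary of a chain of edges of `M`, as a function on all points of the plane. The chain
is a function on all edges, of which only the values on the edges of `M` matter. -/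
def MeshData.bd (M : MeshData) (x : Edge → V) (p : ℝ × ℝ) : V :=
  ∑ τ ∈ M.edges, τ.incidence p • x τ

theorem MeshData.bd_congr {M : MeshData} {x x' : Edge → V} (h : ∀ τ ∈ M.edges, x τ = x' τ)
    (p : ℝ × ℝ) : M.bd x p = M.bd x' p :=
  Finset.sum_congr rfl fun τ hτ => by rw [h τ hτ]

theorem MeshData.bd_add (M : MeshData) (x x' : Edge → V) (p : ℝ × ℝ) :
    M.bd (x + x') p = M.bd x p + M.bd x' p := by
  simp [MeshData.bd, Finset.sum_add_distrib]

theorem MeshData.bd_sub (M : MeshData) (x x' : Edge → V) (p : ℝ × ℝ) :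
    M.bd (x - x') p = M.bd x p - M.bd x' p := by
  simp [MeshData.bd, smul_sub]

theorem MeshData.bd_single {M : MeshData} {τ : Edge} (hτ : τ ∈ M.edges) (q : V) (p : ℝ × ℝ) :
    M.bd (Pi.single τ q) p = τ.incidence p • q := by
  rw [MeshData.bd, Finset.sum_eq_single_of_mem τ hτ]
  · simp
  · intro τ' _ h
    simp [h]

theorem Edge.incidence_of_not_mem {τ : Edge} {p : ℝ × ℝ} (h : p ∉ τ.toSet) :
    τ.incidence p = 0 := by
  have h1 : p ≠ τ.tgt := fun h' => h (h' ▸ τ.tgt_mem)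
  have h2 : p ≠ τ.src := fun h' => h (h' ▸ τ.src_mem)
  simp [Edge.incidence, h1, h2]

theorem Edge.src_ne_tgt (τ : Edge) : τ.src ≠ τ.tgt := by
  intro h
  have := ((τ.eq_tgt_iff _).mp h).1
  simp only [Edge.src, Dir.coord_point] at this
  exact τ.lo_lt_hi.ne this

theorem Edge.incidence_cut (τ : Edge) {c : ℝ} (h₁ : τ.lo < c) (h₂ : c < τ.hi) (p : ℝ × ℝ) :
    τ.incidence p = (τ.left c h₁).incidence p + (τ.right c h₂).incidence p := by
  have h : (τ.right c h₂).src = (τ.left c h₁).tgt := rfl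
  have h' : (τ.left c h₁).src = τ.src := rfl
  have h'' : (τ.right c h₂).tgt = τ.tgt := rfl
  simp only [Edge.incidence, h, h', h'']
  ring

theorem Edge.left_ne_right (τ : Edge) {c : ℝ} (h₁ : τ.lo < c) (h₂ : c < τ.hi) :
    τ.left c h₁ ≠ τ.right c h₂ := by
  intro h
  have : τ.lo = c := congrArg Edge.lo h
  exact h₁.ne this

theorem IsTiling.left_not_mem {R : Rect} {M : MeshData} (hM : IsTiling R M) {τ : Edge}
    (hτ : τ ∈ M.edges) {c : ℝ} (h₁ : τ.lo < c) (h₂ : c < τ.hi) : τ.left c h₁ ∉ M.edges := by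
  intro h
  obtain ⟨p, hp⟩ := (τ.left c h₁).nonempty_relInterior
  have h3 := hM.eq_of_mem_relInterior h hτ hp
    (Edge.mem_left h₂ ((τ.left c h₁).relInterior_subset hp)).1
  exact h₂.ne (congrArg Edge.hi h3)

theorem IsTiling.right_not_mem {R : Rect} {M : MeshData} (hM : IsTiling R M) {τ : Edge}
    (hτ : τ ∈ M.edges) {c : ℝ} (h₁ : τ.lo < c) (h₂ : c < τ.hi) : τ.right c h₂ ∉ M.edges := by
  intro h
  obtain ⟨p, hp⟩ := (τ.right c h₂).nonempty_relInterior
  have h3 := hM.eq_of_mem_relInterior h hτ hp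
    (Edge.mem_right h₁ ((τ.right c h₂).relInterior_subset hp)).1
  exact h₁.ne' (congrArg Edge.lo h3)

/-- The boundary of a chain after cutting an edge: a chain with the same value on the two parts
has the boundary of the chain before the cut. -/
theorem IsTiling.bd_cutEdge {R : Rect} {M : MeshData} (hM : IsTiling R M) {τ : Edge}
    (hτ : τ ∈ M.edges) {c : ℝ} (h₁ : τ.lo < c) (h₂ : c < τ.hi) (x : Edge → V) (p : ℝ × ℝ) :
    (M.cutEdge τ c h₁ h₂).bd x p = M.bd (Function.update x τ (x (τ.left c h₁))) p +
      (τ.right c h₂).incidence p • (x (τ.right c h₂) - x (τ.left c h₁)) := by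
  have hl := hM.left_not_mem hτ h₁ h₂
  have hr := hM.right_not_mem hτ h₁ h₂
  have h3 : M.bd (Function.update x τ (x (τ.left c h₁))) p =
      τ.incidence p • x (τ.left c h₁) + ∑ τ' ∈ M.edges.erase τ, τ'.incidence p • x τ' := by
    rw [MeshData.bd, ← Finset.add_sum_erase _ _ hτ, Function.update_self]
    congr 1
    refine Finset.sum_congr rfl fun τ' hτ' => ?_
    rw [Function.update_of_ne (Finset.mem_erase.mp hτ').1]
  rw [h3, MeshData.bd, MeshData.cutEdge, Finset.sum_insert, Finset.sum_insert,
    τ.incidence_cut h₁ h₂]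
  · module
  · exact fun h => hr (Finset.mem_of_mem_erase h)
  · rw [Finset.mem_insert, not_or]
    exact ⟨τ.left_ne_right h₁ h₂, fun h => hl (Finset.mem_of_mem_erase h)⟩

theorem Rect.mem_of_mem_cross {σ : Rect} {d : Dir} {t : ℝ} (h₁ : σ.lo d.flip < t)
    (h₂ : t < σ.hi d.flip) {p : ℝ × ℝ} (hp : p ∈ (σ.cross d t).relInterior) : p ∈ σ.toSet := by
  rw [Edge.mem_relInterior] at hp
  simp only [Rect.cross] at hp
  rw [Rect.mem_toSet _ d, hp.1]
  exact ⟨hp.2, h₁, h₂⟩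

theorem IsTiling.cross_not_mem {R : Rect} {M : MeshData} (hM : IsTiling R M) {σ : Rect}
    (hσ : σ ∈ M.faces) {d : Dir} {t : ℝ} (h₁ : σ.lo d.flip < t) (h₂ : t < σ.hi d.flip) :
    σ.cross d t ∉ M.edges := by
  intro h
  obtain ⟨p, hp⟩ := (σ.cross d t).nonempty_relInterior
  exact hM.edge_face _ h p ((σ.cross d t).relInterior_subset hp) σ hσ
    (Rect.mem_of_mem_cross h₁ h₂ hp)

theorem IsTiling.bd_splitFace {R : Rect} {M : MeshData} (hM : IsTiling R M) {σ : Rect}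
    (hσ : σ ∈ M.faces) {d : Dir} {t : ℝ} (h₁ : σ.lo d.flip < t) (h₂ : t < σ.hi d.flip)
    (x : Edge → V) (p : ℝ × ℝ) : (M.splitFace σ d t h₁ h₂).bd x p =
      (σ.cross d t).incidence p • x (σ.cross d t) + M.bd x p := by
  rw [MeshData.bd, MeshData.splitFace, Finset.sum_insert (hM.cross_not_mem hσ h₁ h₂)]
  rfl

/-- An edge that meets the interior of the domain is in the interior except for its end points. -/
theorem IsTiling.mem_of_mem_relInterior {R : Rect} {M : MeshData} (hM : IsTiling R M) {τ : Edge}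
    (hτ : τ ∈ M.edges) {g p : ℝ × ℝ} (hg : g ∈ τ.toSet) (hgR : g ∈ R.toSet)
    (hp : p ∈ τ.relInterior) : p ∈ R.toSet := by
  rw [Edge.mem_toSet] at hg
  rw [Edge.mem_relInterior] at hp
  rw [Rect.mem_toSet _ τ.dir] at *
  have := hM.edge_le τ hτ
  rw [hg.1] at hgR
  rw [hp.1]
  exact ⟨⟨this.1.trans_lt hp.2.1, hp.2.2.trans_le this.2⟩, hgR.2⟩

/-! ### Multiples of vertices that are boundaries -/

/-- The multiple `q` of the vertex `γ` is, at the interior points of the domain, the boundary of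
a chain of edges with coefficients in `J`. -/
def IsBoundary (R : Rect) (M : MeshData) (J : Edge → Submodule ℝ V) (γ : ℝ × ℝ) (q : V) : Prop :=
  ∃ x : Edge → V, (∀ τ ∈ M.edges, x τ ∈ J τ) ∧
    ∀ p ∈ R.toSet, M.bd x p = if p = γ then q else 0

section

variable {R : Rect} {M : MeshData} {J : Edge → Submodule ℝ V}

theorem IsBoundary.of_not_mem {γ : ℝ × ℝ} (h : γ ∉ R.toSet) (q : V) : IsBoundary R M J γ q := by
  refine ⟨0, fun τ _ => Submodule.zero_mem _, fun p hp => ?_⟩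
  have : p ≠ γ := fun h' => h (h' ▸ hp)
  simp [MeshData.bd, this]

theorem IsBoundary.add {γ : ℝ × ℝ} {q q' : V} (h : IsBoundary R M J γ q)
    (h' : IsBoundary R M J γ q') : IsBoundary R M J γ (q + q') := by
  obtain ⟨x, hx, hb⟩ := h
  obtain ⟨x', hx', hb'⟩ := h'
  refine ⟨x + x', fun τ hτ => Submodule.add_mem _ (hx τ hτ) (hx' τ hτ), fun p hp => ?_⟩
  rw [MeshData.bd_add, hb p hp, hb' p hp]
  split_ifs <;> simp

theorem IsBoundary.mono {J' : Edge → Submodule ℝ V} (hJ : ∀ τ ∈ M.edges, J τ ≤ J' τ)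
    {γ : ℝ × ℝ} {q : V} (h : IsBoundary R M J γ q) : IsBoundary R M J' γ q := by
  obtain ⟨x, hx, hb⟩ := h
  exact ⟨x, fun τ hτ => hJ τ hτ (hx τ hτ), hb⟩

/-- A coefficient of an edge can be moved from one end of the edge to the other. -/
theorem isBoundary_src_iff_tgt {τ : Edge} (hτ : τ ∈ M.edges) {q : V} (hq : q ∈ J τ) :
    IsBoundary R M J τ.src q ↔ IsBoundary R M J τ.tgt q := by
  have hmem : ∀ c : ℝ, ∀ τ' ∈ M.edges, (Pi.single τ (c • q) : Edge → V) τ' ∈ J τ' := by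
    intro c τ' _
    by_cases h : τ' = τ
    · subst h
      simpa using Submodule.smul_mem _ c hq
    · simp [h]
  constructor
  · rintro ⟨x, hx, hb⟩
    refine ⟨x + Pi.single τ ((1 : ℝ) • q),
      fun τ' h => Submodule.add_mem _ (hx τ' h) (hmem 1 τ' h), fun p hp => ?_⟩
    rw [MeshData.bd_add, hb p hp, MeshData.bd_single hτ, Edge.incidence]
    split_ifs <;> simp
  · rintro ⟨x, hx, hb⟩
    refine ⟨x + Pi.single τ ((-1 : ℝ) • q),
      fun τ' h => Submodule.add_mem _ (hx τ' h) (hmem (-1) τ' h), fun p hp => ?_⟩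
    rw [MeshData.bd_add, hb p hp, MeshData.bd_single hτ, Edge.incidence]
    split_ifs <;> simp

theorem IsBoundary.of_src {τ : Edge} (hτ : τ ∈ M.edges) {q : V} (hq : q ∈ J τ)
    (h : IsBoundary R M J τ.src q) {γ : ℝ × ℝ} (hγ : γ = τ.src ∨ γ = τ.tgt) :
    IsBoundary R M J γ q := by
  rcases hγ with rfl | rfl
  · exact h
  · exact (isBoundary_src_iff_tgt hτ hq).mp h

/-- The coefficients of each edge are sums of coefficients that it shares with any two
perpendicular edges on different lines. -/
def SplitsAcross (M : MeshData) (J : Edge → Submodule ℝ V) : Prop :=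
  ∀ τ ∈ M.edges, ∀ v₁ ∈ M.edges, ∀ v₂ ∈ M.edges, v₁.dir = τ.dir.flip → v₂.dir = τ.dir.flip →
    v₁.pos ≠ v₂.pos → ∀ q ∈ J τ, ∃ q₁ q₂, q = q₁ + q₂ ∧ q₁ ∈ J τ ∧ q₂ ∈ J τ ∧
      q₁ ∈ J v₁ ∧ q₂ ∈ J v₂

/-- Collinear edges that meet in an interior point of the domain have the same coefficients. -/
def ConstantAlong (R : Rect) (M : MeshData) (J : Edge → Submodule ℝ V) : Prop :=
  ∀ τ ∈ M.edges, ∀ τ' ∈ M.edges, τ.dir = τ'.dir → τ.tgt = τ'.src → τ.tgt ∈ R.toSet → J τ = J τ'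

end

theorem IsTiling.isBoundary_cutEdge {R : Rect} {M : MeshData} (hM : IsTiling R M) {τ : Edge}
    (hτ : τ ∈ M.edges) {c : ℝ} (h₁ : τ.lo < c) (h₂ : c < τ.hi) {J : Edge → Submodule ℝ V}
    (hJ : τ.dir.point c τ.pos ∈ R.toSet → J (τ.left c h₁) = J (τ.right c h₂)) {γ : ℝ × ℝ} {q : V}
    (h : IsBoundary R M (Function.update J τ (J (τ.left c h₁))) γ q) :
    IsBoundary R (M.cutEdge τ c h₁ h₂) J γ q := by
  have hp₀ : τ.dir.point c τ.pos ∈ τ.relInterior := ⟨c, ⟨h₁, h₂⟩, rfl⟩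
  obtain ⟨x, hx, hb⟩ := h
  -- The coefficient of an edge in the boundary of the domain may be replaced by `0`.
  obtain ⟨x, hx, hxr, hb⟩ : ∃ x : Edge → V,
      (∀ τ' ∈ M.edges, x τ' ∈ Function.update J τ (J (τ.left c h₁)) τ') ∧
      x τ ∈ J (τ.right c h₂) ∧ ∀ p ∈ R.toSet, M.bd x p = if p = γ then q else 0 := by
    by_cases h : τ.dir.point c τ.pos ∈ R.toSet
    · refine ⟨x, hx, ?_, hb⟩
      rw [← hJ h]
      simpa using hx τ hτ
    · refine ⟨x - Pi.single τ (x τ), fun τ' h' => Submodule.sub_mem _ (hx τ' h') ?_, ?_, ?_⟩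
      · by_cases h3 : τ' = τ
        · subst h3
          simpa using hx τ' hτ
        · simp [h3]
      · simp
      · intro p hp
        rw [MeshData.bd_sub, MeshData.bd_single hτ, hb p hp, Edge.incidence_of_not_mem, zero_smul,
          sub_zero]
        exact fun hpτ => h (hM.mem_of_mem_relInterior hτ hpτ hp hp₀)
  have hl := hM.left_not_mem hτ h₁ h₂
  have hr := hM.right_not_mem hτ h₁ h₂
  set x' : Edge → V :=
    Function.update (Function.update x (τ.left c h₁) (x τ)) (τ.right c h₂) (x τ) with hx'
  have hx'l : x' (τ.left c h₁) = x τ := by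
    simp [hx', Function.update_of_ne (τ.left_ne_right h₁ h₂)]
  have hx'r : x' (τ.right c h₂) = x τ := by simp [hx']
  have hx'o : ∀ τ' ∈ M.edges, x' τ' = x τ' := by
    intro τ' h
    rw [hx', Function.update_of_ne (by rintro rfl; exact hr h),
      Function.update_of_ne (by rintro rfl; exact hl h)]
  refine ⟨x', fun τ' h => ?_, fun p hp => ?_⟩
  · simp only [MeshData.cutEdge, Finset.mem_insert, Finset.mem_erase] at h
    rcases h with rfl | rfl | h
    · rw [hx'l]
      simpa using hx τ hτ
    · rwa [hx'r]
    · rw [hx'o τ' h.2]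
      simpa [h.1] using hx τ' h.2
  · rw [hM.bd_cutEdge hτ h₁ h₂, hx'l, hx'r, sub_self, smul_zero, add_zero, ← hb p hp]
    refine MeshData.bd_congr (fun τ' h => ?_) p
    by_cases h3 : τ' = τ
    · subst h3
      simp
    · rw [Function.update_of_ne h3, hx'o τ' h]

theorem IsTiling.isBoundary_splitFace {R : Rect} {M : MeshData} (hM : IsTiling R M) {σ : Rect}
    (hσ : σ ∈ M.faces) {d : Dir} {t : ℝ} (h₁ : σ.lo d.flip < t) (h₂ : t < σ.hi d.flip)
    {J : Edge → Submodule ℝ V} {γ : ℝ × ℝ} {q : V} (h : IsBoundary R M J γ q) :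
    IsBoundary R (M.splitFace σ d t h₁ h₂) J γ q := by
  obtain ⟨x, hx, hb⟩ := h
  have he := hM.cross_not_mem hσ h₁ h₂
  refine ⟨Function.update x (σ.cross d t) 0, fun τ hτ => ?_, fun p hp => ?_⟩
  · rcases Finset.mem_insert.mp hτ with rfl | hτ
    · simp
    · rw [Function.update_of_ne (by rintro rfl; exact he hτ)]
      exact hx τ hτ
  · rw [hM.bd_splitFace hσ h₁ h₂, Function.update_self, smul_zero, zero_add, ← hb p hp]
    refine MeshData.bd_congr (fun τ hτ => ?_) p
    rw [Function.update_of_ne (by rintro rfl; exact he hτ)]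

/-- At an end point of the edge that splits a face, there is a perpendicular edge, which is part
of the boundary of the split face. -/
theorem IsTiling.exists_perp {R : Rect} {M : MeshData} (hM : IsTiling R M) {σ : Rect}
    (hσ : σ ∈ M.faces) {d : Dir} {t : ℝ} (h₁ : σ.lo d.flip < t) (h₂ : t < σ.hi d.flip) (b : Bool)
    (hv : d.point (σ.side b d) t ∈ M.vertices) : ∃ v ∈ M.edges, v.dir = d.flip ∧
      v.pos = σ.side b d ∧ (d.point (σ.side b d) t = v.src ∨ d.point (σ.side b d) t = v.tgt) := by
  obtain ⟨τ, hτ, hd, hpos, hg⟩ := hM.cover σ hσ d.flip b true (d.point (σ.side b d) t) (by simp)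
    (.of_mem_Ioo _ (by simpa using h₁) (by simpa using h₂))
  refine ⟨τ, hτ, hd, by simpa using hpos, hM.eq_end _ hv τ hτ ?_⟩
  rw [Edge.mem_toSet, hd]
  exact ⟨hpos.symm, hg.mem_Icc⟩

/-- If collinear edges have the same coefficients, then all multiples of vertices by coefficients
of adjacent edges are boundaries. The reason is that the edge that splits a face ends at edges
that are perpendicular to it and were there before. -/
theorem Built.isBoundary {R : Rect} {M : MeshData} (hB : Built R M) :
    ∀ J : Edge → Submodule ℝ V, ConstantAlong R M J → SplitsAcross M J →
      ∀ τ ∈ M.edges, ∀ q ∈ J τ, IsBoundary R M J τ.src q := by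
  induction hB with
  | single =>
    intro J _ _ τ hτ q _
    apply IsBoundary.of_not_mem
    intro h
    obtain ⟨-, -, b, hb⟩ := mem_single_edges hτ
    rw [Rect.mem_toSet _ τ.dir] at h
    exact side_not_mem_Ioo (d := τ.dir.flip) (by simpa [Edge.src] using hb) h.2
  | cutEdge M τ c h₁ h₂ hB hτ ih =>
    intro J hconst hsplit
    have hM := hB.isTiling
    have hp₀ : τ.dir.point c τ.pos ∈ τ.relInterior := ⟨c, ⟨h₁, h₂⟩, rfl⟩
    have hml : τ.left c h₁ ∈ (M.cutEdge τ c h₁ h₂).edges := by simp [MeshData.cutEdge]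
    have hmr : τ.right c h₂ ∈ (M.cutEdge τ c h₁ h₂).edges := by simp [MeshData.cutEdge]
    have hmo : ∀ τ' ∈ M.edges, τ' ≠ τ → τ' ∈ (M.cutEdge τ c h₁ h₂).edges := fun τ' h h' => by
      simp [MeshData.cutEdge, h, h']
    have hlr : τ.dir.point c τ.pos ∈ R.toSet → J (τ.left c h₁) = J (τ.right c h₂) :=
      fun h => hconst _ hml _ hmr rfl rfl h
    have hconst' : ConstantAlong R M (Function.update J τ (J (τ.left c h₁))) := by
      intro a ha b hb hd he hR
      by_cases haτ : a = τ <;> by_cases hbτ : b = τ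
      · rw [haτ, hbτ]
      · subst haτ
        rw [Function.update_self, Function.update_of_ne hbτ,
          hlr (hM.mem_of_mem_relInterior hτ a.tgt_mem hR hp₀)]
        exact hconst _ hmr b (hmo b hb hbτ) hd he hR
      · subst hbτ
        rw [Function.update_self, Function.update_of_ne haτ]
        exact hconst a (hmo a ha haτ) _ hml hd he hR
      · rw [Function.update_of_ne haτ, Function.update_of_ne hbτ]
        exact hconst a (hmo a ha haτ) b (hmo b hb hbτ) hd he hR
    have hsplit' : SplitsAcross M (Function.update J τ (J (τ.left c h₁))) := by
      have hrep : ∀ a ∈ M.edges, ∃ a' ∈ (M.cutEdge τ c h₁ h₂).edges, a'.dir = a.dir ∧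
          a'.pos = a.pos ∧ Function.update J τ (J (τ.left c h₁)) a = J a' := by
        intro a ha
        by_cases h : a = τ
        · subst h
          exact ⟨_, hml, rfl, rfl, by simp⟩
        · exact ⟨a, hmo a ha h, rfl, rfl, by simp [h]⟩
      intro a ha v₁ hv₁ v₂ hv₂ hd₁ hd₂ hne
      obtain ⟨a', ha', ha'd, -, e⟩ := hrep a ha
      obtain ⟨v₁', hv₁', hd₁', hp₁, e₁⟩ := hrep v₁ hv₁
      obtain ⟨v₂', hv₂', hd₂', hp₂, e₂⟩ := hrep v₂ hv₂
      rw [e, e₁, e₂]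
      exact hsplit a' ha' v₁' hv₁' v₂' hv₂' (by rw [hd₁', ha'd, hd₁]) (by rw [hd₂', ha'd, hd₂])
        (by rwa [hp₁, hp₂])
    have hold : ∀ τ' ∈ M.edges, ∀ q ∈ Function.update J τ (J (τ.left c h₁)) τ',
        IsBoundary R (M.cutEdge τ c h₁ h₂) J τ'.src q := fun τ' h q hq =>
      hM.isBoundary_cutEdge hτ h₁ h₂ hlr (ih _ hconst' hsplit' τ' h q hq)
    have hleft : ∀ q ∈ J (τ.left c h₁), IsBoundary R (M.cutEdge τ c h₁ h₂) J τ.src q :=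
      fun q hq => hold τ hτ q (by simpa using hq)
    intro τ' hτ' q hq
    have hτ'' := hτ'
    simp only [MeshData.cutEdge, Finset.mem_insert, Finset.mem_erase] at hτ''
    rcases hτ'' with rfl | rfl | h
    · exact hleft q hq
    · by_cases hR : τ.dir.point c τ.pos ∈ R.toSet
      · rw [← hlr hR] at hq
        exact (isBoundary_src_iff_tgt hml hq).mp (hleft q hq)
      · exact .of_not_mem hR q
    · exact hold τ' h.2 q (by simpa [h.1] using hq)
  | splitFace M σ d t h₁ h₂ hB hσ hs ht ih =>
    intro J hconst hsplit
    have hM := hB.isTiling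
    have hsub : ∀ τ ∈ M.edges, τ ∈ (M.splitFace σ d t h₁ h₂).edges := fun τ h =>
      Finset.mem_insert_of_mem h
    have hcross : σ.cross d t ∈ (M.splitFace σ d t h₁ h₂).edges := Finset.mem_insert_self _ _
    have hold : ∀ τ ∈ M.edges, ∀ q ∈ J τ, ∀ γ, γ = τ.src ∨ γ = τ.tgt →
        IsBoundary R (M.splitFace σ d t h₁ h₂) J γ q := fun τ h q hq γ hγ =>
      .of_src (hsub τ h) hq (hM.isBoundary_splitFace hσ h₁ h₂
        (ih J (fun a ha b hb => hconst a (hsub a ha) b (hsub b hb))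
          (fun a ha v hv w hw => hsplit a (hsub a ha) v (hsub v hv) w (hsub w hw)) τ h q hq)) hγ
    intro τ hτ q hq
    rcases Finset.mem_insert.mp hτ with rfl | h
    · obtain ⟨v₁, hv₁, hd₁, hp₁, he₁⟩ := hM.exists_perp hσ h₁ h₂ true hs
      obtain ⟨v₂, hv₂, hd₂, hp₂, he₂⟩ := hM.exists_perp hσ h₁ h₂ false ht
      obtain ⟨q₁, q₂, rfl, hq₁, hq₂, hq₁', hq₂'⟩ := hsplit _ hcross v₁ (hsub v₁ hv₁) v₂
        (hsub v₂ hv₂) hd₁ hd₂ (by rw [hp₁, hp₂]; exact (σ.lo_lt_hi d).ne) q hq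
      exact .add (hold v₁ hv₁ q₁ hq₁' _ he₁)
        ((isBoundary_src_iff_tgt hcross hq₂).mpr (hold v₂ hv₂ q₂ hq₂' _ he₂))
    · exact hold τ h q hq _ (Or.inl rfl)

/-- If all multiples of vertices by coefficients in `J` of adjacent edges are boundaries, then this
remains true for larger coefficients, provided that these can be split. -/
theorem IsBoundary.of_le {R : Rect} {M : MeshData} (hM : IsTiling R M)
    (hc : ∀ γ ∈ M.vertices, γ ∈ R.toSet → M.IsCorner γ) {J J' : Edge → Submodule ℝ V}
    (hJ : ∀ τ ∈ M.edges, ∀ q ∈ J τ, IsBoundary R M J τ.src q) (hle : ∀ τ ∈ M.edges, J τ ≤ J' τ)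
    (hsplit : ∀ τ ∈ M.edges, ∀ v₁ ∈ M.edges, ∀ v₂ ∈ M.edges, v₁.dir = τ.dir.flip →
      v₂.dir = τ.dir.flip → v₁.pos ≠ v₂.pos → ∀ q ∈ J' τ, ∃ q₁ q₂, q = q₁ + q₂ ∧ q₁ ∈ J' τ ∧
      q₂ ∈ J' τ ∧ q₁ ∈ J v₁ ∧ q₂ ∈ J v₂) {τ : Edge} (hτ : τ ∈ M.edges) {q : V} (hq : q ∈ J' τ) :
    IsBoundary R M J' τ.src q := by
  by_cases hs : τ.src ∈ R.toSet
  swap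
  · exact .of_not_mem hs q
  by_cases ht : τ.tgt ∈ R.toSet
  swap
  · exact (isBoundary_src_iff_tgt hτ hq).mpr (.of_not_mem ht q)
  obtain ⟨v₁, hv₁, hd₁, he₁⟩ := hc _ (hM.src_mem τ hτ) hs τ.dir.flip
  obtain ⟨v₂, hv₂, hd₂, he₂⟩ := hc _ (hM.tgt_mem τ hτ) ht τ.dir.flip
  have hp₁ : v₁.pos = τ.lo := by
    rw [Edge.eq_src_iff, Edge.eq_tgt_iff, hd₁] at he₁
    rcases he₁ with h | h <;> simpa [Edge.src] using h.2.symm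
  have hp₂ : v₂.pos = τ.hi := by
    rw [Edge.eq_src_iff, Edge.eq_tgt_iff, hd₂] at he₂
    rcases he₂ with h | h <;> simpa [Edge.tgt] using h.2.symm
  obtain ⟨q₁, q₂, rfl, hq₁, hq₂, hq₁', hq₂'⟩ := hsplit τ hτ v₁ hv₁ v₂ hv₂ hd₁ hd₂
    (by rw [hp₁, hp₂]; exact τ.lo_lt_hi.ne) q hq
  have hold : ∀ v ∈ M.edges, ∀ q ∈ J v, ∀ γ, γ = v.src ∨ γ = v.tgt → IsBoundary R M J' γ q :=
    fun v hv q hq γ hγ => .mono hle (.of_src hv hq (hJ v hv q hq) hγ)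
  exact .add (hold v₁ hv₁ q₁ hq₁' _ he₁)
    ((isBoundary_src_iff_tgt hτ hq₂).mpr (hold v₂ hv₂ q₂ hq₂' _ he₂))

end

section

variable {V : Type*} [AddCommGroup V]

/-! ### The jumps of a function on the faces -/

/-- The sign that makes the jumps across the edges around a point add up to zero. -/
def Dir.sign : Dir → ℝ
  | .horizontal => 1
  | .vertical => -1

theorem Dir.sign_mul_self (d : Dir) : d.sign * d.sign = 1 := by cases d <;> simp [Dir.sign]

/-- The value of a function on the faces at the face that contains a quadrant at `p`. The sum has
at most one summand. -/
def MeshData.germVal (M : MeshData) (y : Rect → V) (d : Dir) (s b : Bool) (p : ℝ × ℝ) : V :=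
  ∑ σ ∈ M.faces with σ.Germ d s b p, y σ

theorem MeshData.germVal_flip (M : MeshData) (y : Rect → V) (d : Dir) (s b : Bool) (p : ℝ × ℝ) :
    M.germVal y d.flip b s p = M.germVal y d s b p := by
  simp only [MeshData.germVal, Rect.germ_flip]

variable {R : Rect} {M : MeshData}

theorem IsTiling.germVal_eq (hM : IsTiling R M) (y : Rect → V) {d : Dir} {s b : Bool} {p : ℝ × ℝ}
    {σ : Rect} (hσ : σ ∈ M.faces) (h : σ.Germ d s b p) : M.germVal y d s b p = y σ := by
  rw [MeshData.germVal, Finset.sum_eq_single_of_mem σ (by simp [hσ, h])]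
  intro σ' hσ' hne
  rw [Finset.mem_filter] at hσ'
  exact absurd (hM.germ_unique d s b p σ' hσ'.1 σ hσ hσ'.2 h) hne

theorem Rect.IsSide.germ_src {b : Bool} {σ : Rect} {τ : Edge} (h : σ.IsSide b τ) :
    σ.Germ τ.dir true b τ.src := by
  refine h.germ (by simp [Edge.src]) ?_
  simpa [InGerm, Edge.src] using τ.lo_lt_hi

theorem IsTiling.isSide_unique (hM : IsTiling R M) {b : Bool} {σ σ' : Rect} (hσ : σ ∈ M.faces)
    (hσ' : σ' ∈ M.faces) {τ : Edge} (h : σ.IsSide b τ) (h' : σ'.IsSide b τ) : σ = σ' :=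
  hM.germ_unique τ.dir true b τ.src σ hσ σ' hσ' h.germ_src h'.germ_src

variable [Module ℝ V]

/-- The jump across an edge of a function on the faces: up to the sign of the direction, the
difference of its values on the two faces along the edge. The sums have at most one summand. -/
def MeshData.jump (M : MeshData) (y : Rect → V) (τ : Edge) : V :=
  τ.dir.sign • (∑ σ ∈ M.faces with σ.IsSide true τ, y σ -
    ∑ σ ∈ M.faces with σ.IsSide false τ, y σ)

theorem IsTiling.jump_eq (hM : IsTiling R M) (y : Rect → V) {τ : Edge} {σ σ' : Rect}
    (hσ : σ ∈ M.faces) (hσ' : σ' ∈ M.faces) (h : σ.IsSide true τ) (h' : σ'.IsSide false τ) :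
    M.jump y τ = τ.dir.sign • (y σ - y σ') := by
  rw [MeshData.jump, Finset.sum_eq_single_of_mem σ (by simp [hσ, h]),
    Finset.sum_eq_single_of_mem σ' (by simp [hσ', h'])]
  · intro σ'' hσ'' hne
    rw [Finset.mem_filter] at hσ''
    exact absurd (hM.isSide_unique hσ''.1 hσ' hσ''.2 h') hne
  · intro σ'' hσ'' hne
    rw [Finset.mem_filter] at hσ''
    exact absurd (hM.isSide_unique hσ''.1 hσ hσ''.2 h) hne

theorem MeshData.jump_add (y y' : Rect → V) (τ : Edge) :
    M.jump (y + y') τ = M.jump y τ + M.jump y' τ := by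
  simp only [MeshData.jump, Pi.add_apply, Finset.sum_add_distrib]
  module

theorem MeshData.jump_smul (c : ℝ) (y : Rect → V) (τ : Edge) :
    M.jump (c • y) τ = c • M.jump y τ := by
  simp only [MeshData.jump, Pi.smul_apply, ← Finset.smul_sum]
  module

/-- The sum of a chain of edges over the edges in direction `d` that contain the points next to `p`
on the side given by `s`. -/
def MeshData.edgeGermVal (M : MeshData) (x : Edge → V) (d : Dir) (s : Bool) (p : ℝ × ℝ) : V :=
  ∑ τ ∈ M.edges with τ.dir = d ∧ τ.pos = d.flip.coord p ∧ InGerm s τ.lo τ.hi (d.coord p), x τ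

theorem Edge.incidence_eq (τ : Edge) (p : ℝ × ℝ) : τ.incidence p =
    (if τ.pos = τ.dir.flip.coord p ∧ InGerm false τ.lo τ.hi (τ.dir.coord p) then 1 else 0) -
    (if τ.pos = τ.dir.flip.coord p ∧ InGerm true τ.lo τ.hi (τ.dir.coord p) then 1 else 0) := by
  simp only [Edge.incidence, Edge.eq_src_iff, Edge.eq_tgt_iff, InGerm]
  have := τ.lo_lt_hi
  by_cases hp : τ.pos = τ.dir.flip.coord p
  · simp only [hp, true_and, and_true]
    split_ifs <;> grind
  · simp [hp, Ne.symm hp]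

/-- The boundary of a chain at `p` in terms of the values on the four edges around `p`. An edge that
contains `p` in its relative interior counts twice, with opposite signs. -/
theorem MeshData.bd_eq_edgeGermVal (x : Edge → V) (p : ℝ × ℝ) : M.bd x p =
    (M.edgeGermVal x .horizontal false p - M.edgeGermVal x .horizontal true p) +
    (M.edgeGermVal x .vertical false p - M.edgeGermVal x .vertical true p) := by
  simp only [MeshData.bd, MeshData.edgeGermVal, Finset.sum_filter, ← Finset.sum_sub_distrib,
    ← Finset.sum_add_distrib]
  refine Finset.sum_congr rfl fun τ _ => ?_
  rw [Edge.incidence_eq, sub_smul, ite_smul, ite_smul]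
  rcases h : τ.dir with _ | _ <;> simp

theorem IsTiling.edgeGermVal_jump (hM : IsTiling R M) (y : Rect → V) (d : Dir) (s : Bool)
    {p : ℝ × ℝ} (hp : p ∈ R.toSet) : M.edgeGermVal (M.jump y) d s p =
      d.sign • (M.germVal y d s true p - M.germVal y d s false p) := by
  by_cases h : ∃ τ ∈ M.edges, τ.dir = d ∧ τ.pos = d.flip.coord p ∧ InGerm s τ.lo τ.hi (d.coord p)
  · obtain ⟨τ, hτ, rfl, hpos, hg⟩ := h
    have hpτ : p ∈ τ.toSet := (τ.mem_toSet p).mpr ⟨hpos.symm, hg.mem_Icc⟩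
    obtain ⟨σ, hσ, h1⟩ := hM.exists_isSide τ hτ p hpτ hp true
    obtain ⟨σ', hσ', h2⟩ := hM.exists_isSide τ hτ p hpτ hp false
    rw [hM.germVal_eq y hσ (h1.germ hpos.symm hg), hM.germVal_eq y hσ' (h2.germ hpos.symm hg),
      ← hM.jump_eq y hσ hσ' h1 h2, MeshData.edgeGermVal,
      Finset.sum_eq_single_of_mem τ (by simp [hτ, hpos, hg])]
    intro τ' hτ' hne
    rw [Finset.mem_filter] at hτ'
    obtain ⟨hτ', hd', hpos', hg'⟩ := hτ'
    obtain ⟨z, hz, hz'⟩ := hg.exists_mem_Ioo hg'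
    refine absurd (hM.eq_of_mem_relInterior hτ' hτ (p := τ.dir.point z τ.pos) ?_ ?_) hne
    · rw [Edge.mem_relInterior, hd', hpos', hpos]
      simpa using hz'
    · rw [Edge.mem_toSet]
      simpa using ⟨hz.1.le, hz.2.le⟩
  · -- Without an edge, the two quadrants are in the same face.
    have h0 : M.edgeGermVal (M.jump y) d s p = 0 := by
      rw [MeshData.edgeGermVal, Finset.filter_eq_empty_iff.mpr, Finset.sum_empty]
      exact fun τ hτ h' => h ⟨τ, hτ, h'⟩
    obtain ⟨σ, hσ, h1⟩ := hM.exists_germ d s true p (Rect.germ_of_mem hp _ _ _)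
    have h2 : σ.Germ d s false p := by
      refine ⟨h1.1, .of_mem_Ioo _ (lt_of_le_of_ne h1.2.1 fun he => h ?_) h1.2.2⟩
      exact hM.cover σ hσ d true s p he.symm h1.1
    rw [h0, hM.germVal_eq y hσ h1, hM.germVal_eq y hσ h2, sub_self, smul_zero]

/-- The jumps across the edges around an interior point add up to zero. -/
theorem IsTiling.bd_jump (hM : IsTiling R M) (y : Rect → V) {p : ℝ × ℝ} (hp : p ∈ R.toSet) :
    M.bd (M.jump y) p = 0 := by
  have hf : ∀ s b, M.germVal y .vertical s b p = M.germVal y .horizontal b s p := fun s b =>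
    M.germVal_flip y .horizontal b s p
  rw [MeshData.bd_eq_edgeGermVal]
  simp only [hM.edgeGermVal_jump y _ _ hp, hf, Dir.sign]
  module

/-- A chain of edges without boundary in the interior of the domain consists of jumps. -/
theorem Built.exists_jump (hB : Built R M) :
    ∀ x : Edge → V, (∀ p ∈ R.toSet, M.bd x p = 0) →
      ∃ y : Rect → V, ∀ τ ∈ M.edges, ∀ p ∈ τ.toSet, p ∈ R.toSet → x τ = M.jump y τ := by
  induction hB with
  | single =>
    intro x _
    refine ⟨0, fun τ hτ p hp hpR => ?_⟩
    exfalso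
    obtain ⟨-, -, b, hb⟩ := mem_single_edges hτ
    rw [Edge.mem_toSet] at hp
    rw [Rect.mem_toSet _ τ.dir] at hpR
    exact side_not_mem_Ioo (hp.1.trans hb) hpR.2
  | cutEdge M τ c h₁ h₂ hB hτ ih =>
    intro x hx
    have hM := hB.isTiling
    have hp₀ : τ.dir.point c τ.pos ∈ τ.relInterior := ⟨c, ⟨h₁, h₂⟩, rfl⟩
    have hsrc : (τ.right c h₂).src = τ.dir.point c τ.pos := rfl
    have hlr : τ.dir.point c τ.pos ∈ R.toSet → x (τ.right c h₂) = x (τ.left c h₁) := by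
      intro hR
      have h3 := hx _ hR
      have h4 : M.bd (Function.update x τ (x (τ.left c h₁))) (τ.dir.point c τ.pos) = 0 := by
        refine Finset.sum_eq_zero fun τ' hτ' => ?_
        have h5 : τ'.incidence (τ.dir.point c τ.pos) = 0 := by
          by_cases h6 : τ.dir.point c τ.pos ∈ τ'.toSet
          · rw [← hM.eq_of_mem_relInterior hτ hτ' hp₀ h6]
            have h7 : τ.dir.point c τ.pos ≠ τ.tgt := fun h =>
              Edge.not_mem_relInterior_of_end (Or.inr h) hp₀
            have h8 : τ.dir.point c τ.pos ≠ τ.src := fun h =>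
              Edge.not_mem_relInterior_of_end (Or.inl h) hp₀
            simp [Edge.incidence, h7, h8]
          · exact Edge.incidence_of_not_mem h6
        rw [h5, zero_smul]
      have h5 : (τ.right c h₂).incidence (τ.dir.point c τ.pos) = -1 := by
        have := (τ.right c h₂).src_ne_tgt
        rw [hsrc] at this
        simp [Edge.incidence, hsrc, this]
      rw [hM.bd_cutEdge hτ h₁ h₂, h4, h5, zero_add, neg_one_smul, neg_eq_zero, sub_eq_zero] at h3
      exact h3
    obtain ⟨y, hy⟩ := ih (Function.update x τ (x (τ.left c h₁))) fun p hp => by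
      rw [← hx p hp, hM.bd_cutEdge hτ h₁ h₂]
      by_cases h3 : p ∈ (τ.right c h₂).toSet
      · rw [hlr (hM.mem_of_mem_relInterior hτ (Edge.mem_right h₁ h3).1 hp hp₀), sub_self, smul_zero,
          add_zero]
      · rw [Edge.incidence_of_not_mem h3, zero_smul, add_zero]
    have hpart : ∀ p ∈ τ.toSet, p ∈ R.toSet → ∀ τ' : Edge, τ'.dir = τ.dir → τ'.pos = τ.pos →
        τ.lo ≤ τ'.lo → τ'.hi ≤ τ.hi → x (τ.left c h₁) = (M.cutEdge τ c h₁ h₂).jump y τ' := by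
      intro p hp hpR τ' hd hpos hlo hhi
      obtain ⟨σ, hσ, h3⟩ := hM.exists_isSide τ hτ p hp hpR true
      obtain ⟨σ', hσ', h4⟩ := hM.exists_isSide τ hτ p hp hpR false
      have hside : ∀ {b σ}, Rect.IsSide b σ τ → σ.IsSide b τ' := by
        intro b σ h
        rw [Rect.IsSide, hd, hpos]
        exact ⟨h.1.trans hlo, hhi.trans h.2.1, h.2.2⟩
      have h5 := hy τ hτ p hp hpR
      rw [Function.update_self, hM.jump_eq y hσ hσ' h3 h4, ← hd,
        ← hM.jump_eq y hσ hσ' (hside h3) (hside h4)] at h5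
      exact h5
    refine ⟨y, fun τ' hτ' p hp hpR => ?_⟩
    simp only [MeshData.cutEdge, Finset.mem_insert, Finset.mem_erase] at hτ'
    rcases hτ' with rfl | rfl | h
    · exact hpart p (Edge.mem_left h₂ hp).1 hpR _ rfl rfl le_rfl h₂.le
    · rw [hlr (hM.mem_of_mem_relInterior hτ (Edge.mem_right h₁ hp).1 hpR hp₀)]
      exact hpart p (Edge.mem_right h₁ hp).1 hpR _ rfl rfl h₁.le le_rfl
    · have := hy τ' h.2 p hp hpR
      rwa [Function.update_of_ne h.1] at this
  | splitFace M σ d t h₁ h₂ hB hσ hs ht ih =>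
    intro x hx
    have hM := hB.isTiling
    set M' := M.splitFace σ d t h₁ h₂ with hM'
    have hMt : IsTiling R M' := hM.splitFace hσ h₁ h₂ hs ht
    set τ₀ := σ.cross d t with hτ₀
    set A := σ.upper d.flip t h₂ with hA
    set B := σ.lower d.flip t h₁ with hB'
    have hmA : A ∈ M'.faces := by simp [hM', MeshData.splitFace, hA]
    have hmB : B ∈ M'.faces := by simp [hM', MeshData.splitFace, hB']
    have hAB : A ≠ B := by
      intro h
      have := congrArg (fun σ => Rect.lo σ d.flip) h
      simp only [hA, hB', Rect.upper_lo, Rect.lower_lo] at this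
      exact h₁.ne' this
    have hAside : A.IsSide true τ₀ := by
      have h2 := σ.upper_lo_flip d.flip t h₂
      rw [Dir.flip_flip] at h2
      exact ⟨h2.le, (σ.upper_hi d.flip t h₂ d).ge, (σ.upper_lo d.flip t h₂).symm⟩
    have hBside : B.IsSide false τ₀ := by
      have h2 := σ.lower_hi_flip d.flip t h₁
      rw [Dir.flip_flip] at h2
      exact ⟨(σ.lower_lo d.flip t h₁ d).le, h2.ge, (σ.lower_hi d.flip t h₁).symm⟩
    -- A function on the upper part alone that has the prescribed jump across the new edge.
    set y₁ : Rect → V := Pi.single A (d.sign • x τ₀) with hy₁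
    have hj₁ : M'.jump y₁ τ₀ = x τ₀ := by
      rw [hMt.jump_eq y₁ hmA hmB hAside hBside, hy₁, Pi.single_eq_same, Pi.single_eq_of_ne hAB.symm,
        sub_zero, smul_smul]
      exact (congrArg (· • x τ₀) d.sign_mul_self).trans (one_smul _ _)
    obtain ⟨y, hy⟩ := ih (x - M'.jump y₁) fun p hp => by
      have h3 : M'.bd (x - M'.jump y₁) p = 0 := by
        rw [MeshData.bd_sub, hx p hp, hMt.bd_jump y₁ hp, sub_zero]
      rw [hM', hM.bd_splitFace hσ h₁ h₂] at h3
      rw [← h3, ← hM', ← hτ₀]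
      simp [hj₁]
    -- The function `y` takes the same value on the two parts of the split face.
    set y₂ : Rect → V := fun σ' => if σ' = A ∨ σ' = B then y σ else y σ' with hy₂
    have hval : ∀ {d' s b p}, ∀ σ' ∈ M'.faces, ∀ σ₀ ∈ M.faces, σ'.Germ d' s b p →
        σ₀.Germ d' s b p → y₂ σ' = y σ₀ := by
      intro d' s b p σ' hσ' σ₀ h0 hg hg0
      by_cases h : σ' = A ∨ σ' = B
      · have hgσ : σ.Germ d' s b p := by
          rcases h with rfl | rfl
          · exact hg.mono (σ.upper_le d.flip h₁.le h₂)
          · exact hg.mono (σ.lower_le d.flip h₁ h₂.le)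
        simp only [hy₂, h, if_true]
        rw [hM.germ_unique _ _ _ _ σ hσ σ₀ h0 hgσ hg0]
      · have h3 : σ' ∈ M.faces := by
          simp only [hM', MeshData.splitFace, Finset.mem_union, Finset.mem_insert,
            Finset.mem_singleton, Finset.mem_erase] at hσ'
          tauto
        simp only [hy₂, h, if_false]
        rw [hM.germ_unique _ _ _ _ σ' h3 σ₀ h0 hg hg0]
    refine ⟨y₂ + y₁, fun τ hτ p hp hpR => ?_⟩
    rw [MeshData.jump_add]
    rcases Finset.mem_insert.mp hτ with rfl | h
    · rw [hj₁, hMt.jump_eq y₂ hmA hmB hAside hBside]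
      simp [hy₂, hτ₀]
    · obtain ⟨σ₁, hσ₁, h3⟩ := hM.exists_isSide τ h p hp hpR true
      obtain ⟨σ₂, hσ₂, h4⟩ := hM.exists_isSide τ h p hp hpR false
      obtain ⟨σ₁', hσ₁', h3'⟩ := hMt.exists_isSide τ hτ p hp hpR true
      obtain ⟨σ₂', hσ₂', h4'⟩ := hMt.exists_isSide τ hτ p hp hpR false
      have h5 := hy τ h p hp hpR
      rw [Pi.sub_apply, hM.jump_eq y hσ₁ hσ₂ h3 h4] at h5
      rw [hMt.jump_eq y₂ hσ₁' hσ₂' h3' h4', hval σ₁' hσ₁' σ₁ hσ₁ h3'.germ_src h3.germ_src,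
        hval σ₂' hσ₂' σ₂ hσ₂ h4'.germ_src h4.germ_src, ← h5, sub_add_cancel]

end

section

/-! ### Smoothness across an edge -/

theorem contDiff_max_zero_pow (k : ℕ) : ContDiff ℝ k fun u : ℝ => max u 0 ^ (k + 1) := by
  have hderiv : ∀ (n : ℕ) (u : ℝ),
      HasDerivAt (fun u : ℝ => max u 0 ^ (n + 2)) ((n + 2 : ℝ) * max u 0 ^ (n + 1)) u := by
    intro n u
    have hpow : HasDerivAt (fun u : ℝ => u ^ (n + 2)) ((n + 2 : ℝ) * u ^ (n + 1)) u := by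
      simpa using hasDerivAt_pow (n + 2) u
    rcases lt_trichotomy u 0 with h | rfl | h
    · rw [max_eq_right h.le, zero_pow (by omega), mul_zero]
      refine (hasDerivAt_const u (0 : ℝ)).congr_of_eventuallyEq ?_
      filter_upwards [gt_mem_nhds h] with v hv
      rw [max_eq_right (le_of_lt hv), zero_pow (by omega)]
    · rw [max_self, zero_pow (by omega), mul_zero] at *
      rw [← hasDerivWithinAt_univ, ← Set.Iic_union_Ici (a := (0 : ℝ))]
      refine HasDerivWithinAt.union ?_ ?_
      · refine (hasDerivWithinAt_const 0 _ (0 : ℝ)).congr (fun v hv => ?_) (by simp)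
        rw [max_eq_right hv, zero_pow (by omega)]
      · refine hpow.hasDerivWithinAt.congr (fun v hv => ?_) (by simp)
        rw [max_eq_left hv]
    · rw [max_eq_left h.le]
      refine hpow.congr_of_eventuallyEq ?_
      filter_upwards [lt_mem_nhds h] with v hv
      rw [max_eq_left (le_of_lt hv)]
  induction k with
  | zero =>
    rw [Nat.cast_zero, contDiff_zero]
    fun_prop
  | succ n ih =>
    rw [Nat.cast_succ, contDiff_succ_iff_deriv]
    refine ⟨fun u => (hderiv n u).differentiableAt, by simp, ?_⟩
    rw [funext fun u => (hderiv n u).deriv]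
    exact contDiff_const.mul ih

/-- Two polynomials that are restrictions of a `C^k` function to the two sides of a point agree to
order `k` at this point. -/
theorem X_pow_dvd_sub_of_contDiffAt (k : ℕ) : ∀ (g : ℝ → ℝ) (p q : Polynomial ℝ),
    ContDiffAt ℝ k g 0 → (∀ᶠ u in 𝓝[>] 0, g u = p.eval u) → (∀ᶠ u in 𝓝[<] 0, g u = q.eval u) →
    Polynomial.X ^ (k + 1) ∣ p - q := by
  have hcoeff : ∀ (g : ℝ → ℝ) (p q : Polynomial ℝ), ContinuousAt g 0 →
      (∀ᶠ u in 𝓝[>] 0, g u = p.eval u) → (∀ᶠ u in 𝓝[<] 0, g u = q.eval u) →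
      (p - q).coeff 0 = 0 := by
    intro g p q hg hp hq
    have h1 : g 0 = p.eval 0 := tendsto_nhds_unique (hg.mono_left nhdsWithin_le_nhds)
      ((p.continuous.continuousAt.tendsto.mono_left nhdsWithin_le_nhds).congr'
        (hp.mono fun _ h => h.symm))
    have h2 : g 0 = q.eval 0 := tendsto_nhds_unique (hg.mono_left nhdsWithin_le_nhds)
      ((q.continuous.continuousAt.tendsto.mono_left nhdsWithin_le_nhds).congr'
        (hq.mono fun _ h => h.symm))
    rw [Polynomial.coeff_zero_eq_eval_zero, Polynomial.eval_sub, ← h1, ← h2, sub_self]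
  induction k with
  | zero =>
    intro g p q hg hp hq
    rw [zero_add, pow_one, Polynomial.X_dvd_iff]
    exact hcoeff g p q hg.continuousAt hp hq
  | succ k ih =>
    intro g p q hg hp hq
    have hg' : ContDiffAt ℝ k (deriv g) 0 := by
      rw [Nat.cast_succ] at hg
      exact hg.fderiv_right_succ.clm_apply contDiffAt_const
    have hderiv : ∀ (s : Set ℝ) (p : Polynomial ℝ), IsOpen s → (∀ᶠ u in 𝓝[s] 0, g u = p.eval u) →
        ∀ᶠ u in 𝓝[s] 0, deriv g u = p.derivative.eval u := by
      intro s p hs h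
      rw [← eventually_eventually_nhdsWithin] at h
      filter_upwards [h, self_mem_nhdsWithin] with u hu hus
      rw [hs.nhdsWithin_eq hus] at hu
      rw [Filter.EventuallyEq.deriv_eq (f := fun u => p.eval u) hu, Polynomial.deriv]
    have h := ih (deriv g) _ _ hg' (hderiv _ p isOpen_Ioi hp) (hderiv _ q isOpen_Iio hq)
    rw [Polynomial.X_pow_dvd_iff] at h ⊢
    intro n hn
    rcases n with _ | n
    · exact hcoeff g p q hg.continuousAt hp hq
    · have h1 := h n (by omega)
      rw [← Polynomial.derivative_sub, Polynomial.coeff_derivative] at h1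
      exact (mul_eq_zero.mp h1).resolve_right (by positivity)

theorem contDiff_coord {n : WithTop ℕ∞} (d : Dir) : ContDiff ℝ n d.coord := by
  cases d
  · exact contDiff_fst
  · exact contDiff_snd

theorem contDiff_evalAt {n : WithTop ℕ∞} (p : MvPolynomial (Fin 2) ℝ) :
    ContDiff ℝ n (evalAt p) := by
  unfold evalAt
  induction p using MvPolynomial.induction_on with
  | C a => simpa using contDiff_const
  | add p q hp hq => simpa using hp.add hq
  | mul_X p i hp =>
    simp only [map_mul, MvPolynomial.eval_X]
    refine hp.mul ?_
    fin_cases i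
    · exact contDiff_fst
    · exact contDiff_snd

theorem Edge.evalAt_linearForm (τ : Edge) (z : ℝ × ℝ) :
    evalAt τ.linearForm z = τ.dir.flip.coord z - τ.pos := by
  unfold evalAt Edge.linearForm
  cases τ.dir <;> simp [Dir.flip, Dir.coord]

variable {R : Rect} {M : MeshData}

/-- Near a relative interior point of an edge, the faces are the two faces along the edge. -/
theorem Rect.IsSide.eventually_mem {τ : Edge} {A B : Rect} (hA : A.IsSide true τ)
    (hB : B.IsSide false τ) {x : ℝ × ℝ} (hx : x ∈ τ.relInterior) :
    ∀ᶠ z in 𝓝 x, (τ.pos < τ.dir.flip.coord z → z ∈ A.toSet) ∧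
      (τ.dir.flip.coord z < τ.pos → z ∈ B.toSet) ∧
      (τ.dir.flip.coord z = τ.pos → z ∈ τ.toSet) := by
  rw [Edge.mem_relInterior] at hx
  have hc : ∀ d : Dir, ContinuousAt d.coord x := fun d =>
    (contDiff_coord (n := 0) d).continuous.continuousAt
  have h1 : τ.dir.flip.coord x < A.hi τ.dir.flip := by
    rw [hx.1, hA.2.2]
    exact A.lo_lt_hi _
  have h2 : B.lo τ.dir.flip < τ.dir.flip.coord x := by
    rw [hx.1, hB.2.2]
    exact B.lo_lt_hi _
  have hA' : τ.pos = A.lo τ.dir.flip := hA.2.2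
  have hB' : τ.pos = B.hi τ.dir.flip := hB.2.2
  filter_upwards [(hc τ.dir).eventually (lt_mem_nhds hx.2.1),
    (hc τ.dir).eventually (gt_mem_nhds hx.2.2), (hc τ.dir.flip).eventually (gt_mem_nhds h1),
    (hc τ.dir.flip).eventually (lt_mem_nhds h2)] with z z1 z2 z3 z4
  refine ⟨fun h => ?_, fun h => ?_, fun h => ?_⟩
  · rw [Rect.mem_toSet _ τ.dir]
    exact ⟨⟨hA.1.trans_lt z1, z2.trans_le hA.2.1⟩, hA' ▸ h, z3⟩
  · rw [Rect.mem_toSet _ τ.dir]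
    exact ⟨⟨hB.1.trans_lt z1, z2.trans_le hB.2.1⟩, z4, hB' ▸ h⟩
  · rw [Edge.mem_toSet]
    exact ⟨h, z1.le, z2.le⟩

theorem MeshData.mem_faceUnion {σ : Rect} (hσ : σ ∈ M.faces) {z : ℝ × ℝ} (hz : z ∈ σ.toSet) :
    z ∈ M.faceUnion :=
  Set.mem_biUnion hσ hz

/-- A piecewise polynomial function is `C^k` across an edge if and only if the difference of the
two polynomials along the edge is divisible by the `k + 1`-st power of the linear form. -/
theorem IsTiling.smoothAcross_iff (hM : IsTiling R M) {τ : Edge} (hτ : τ ∈ M.edges) {A B : Rect}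
    (hA : A ∈ M.faces) (hB : B ∈ M.faces) (hAs : A.IsSide true τ) (hBs : B.IsSide false τ)
    {m m' : ℕ} {p q : MvPolynomial (Fin 2) ℝ} (hp : p ∈ biPoly m m') (hq : q ∈ biPoly m m')
    {f : M.faceUnion → ℝ} (hfA : ∀ x : M.faceUnion, x.1 ∈ A.toSet → f x = evalAt p x.1)
    (hfB : ∀ x : M.faceUnion, x.1 ∈ B.toSet → f x = evalAt q x.1) (k : ℤ) :
    SmoothAcross M f τ k ↔ τ.linearForm ^ (k + 1).toNat ∣ p - q := by
  rcases lt_or_ge k 0 with hk | hk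
  · rw [Int.toNat_of_nonpos (by omega), pow_zero]
    exact ⟨fun _ => one_dvd _, fun _ h => absurd h (not_le.mpr hk)⟩
  obtain ⟨n, rfl⟩ := Int.eq_ofNat_of_zero_le hk
  have hn : ((n : ℤ) + 1).toNat = n + 1 := by omega
  have hn' : (n : ℤ).toNat = n := by omega
  unfold SmoothAcross
  rw [hn, hn']
  constructor
  · intro h
    refine linearForm_pow_dvd_of_crossRestrict τ (Submodule.sub_mem _ hp hq)
      (Set.Ioo_infinite τ.lo_lt_hi) fun t ht => ?_
    have hx : τ.dir.point t τ.pos ∈ τ.relInterior := ⟨t, ht, rfl⟩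
    obtain ⟨F, hF, hFf⟩ := h hk _ hx
    set c : ℝ → ℝ × ℝ := fun u => τ.dir.point t (τ.pos + u) with hc
    have hcd : ContDiff ℝ n c := by
      have h1 : ContDiff ℝ n fun u : ℝ => τ.pos + u := contDiff_const.add contDiff_id
      rw [hc]
      rcases τ.dir with _ | _
      · exact contDiff_const.prodMk h1
      · exact h1.prodMk contDiff_const
    have hc0 : c 0 = τ.dir.point t τ.pos := by simp [hc]
    have hcc : Filter.Tendsto c (𝓝 0) (𝓝 (τ.dir.point t τ.pos)) := by
      rw [← hc0]
      exact hcd.continuous.continuousAt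
    have hcoord : ∀ u, τ.dir.flip.coord (c u) = τ.pos + u := fun u => by simp [hc]
    have hev := hcc.eventually (hFf.and (hAs.eventually_mem hBs hx))
    rw [map_sub]
    refine X_pow_dvd_sub_of_contDiffAt n (fun u => F (c u)) _ _ ?_ ?_ ?_
    · refine ContDiffAt.comp 0 (g := F) ?_ hcd.contDiffAt
      rw [hc0]
      exact_mod_cast hF
    · filter_upwards [hev.filter_mono nhdsWithin_le_nhds, self_mem_nhdsWithin] with u hu hu0
      have hmem := hu.2.1 (by rw [hcoord]; exact lt_add_of_pos_right _ hu0)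
      rw [hu.1 (MeshData.mem_faceUnion hA hmem), hfA _ hmem, eval_crossRestrict]
    · filter_upwards [hev.filter_mono nhdsWithin_le_nhds, self_mem_nhdsWithin] with u hu hu0
      have hmem := hu.2.2.1 (by rw [hcoord]; exact add_lt_of_neg_right _ hu0)
      rw [hu.1 (MeshData.mem_faceUnion hB hmem), hfB _ hmem, eval_crossRestrict]
  · rintro ⟨w, hw⟩ - x hx
    -- Add to `q` the difference of the polynomials, cut off below the edge.
    refine ⟨fun z => evalAt q z + max (τ.dir.flip.coord z - τ.pos) 0 ^ (n + 1) * evalAt w z,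
      ?_, ?_⟩
    · have h1 := (contDiff_max_zero_pow n).comp
        ((contDiff_coord (n := n) τ.dir.flip).sub (contDiff_const (c := τ.pos)))
      exact_mod_cast ((contDiff_evalAt q).add (h1.mul (contDiff_evalAt w))).contDiffAt
    · filter_upwards [hAs.eventually_mem hBs hx] with z hz hzf
      rcases lt_trichotomy (τ.dir.flip.coord z) τ.pos with h | h | h
      · rw [hfB ⟨z, hzf⟩ (hz.2.1 h), max_eq_right (by linarith), zero_pow (by omega), zero_mul,
          add_zero]
      · obtain ⟨σ, hσ, hzσ⟩ := Set.mem_iUnion₂.mp hzf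
        exact absurd hzσ (hM.edge_face τ hτ z (hz.2.2 h) σ hσ)
      · rw [hfA ⟨z, hzf⟩ (hz.1 h), max_eq_left (by linarith), ← Edge.evalAt_linearForm]
        have h1 : evalAt (p - q) z = evalAt (τ.linearForm ^ (n + 1) * w) z := by rw [hw]
        simp only [evalAt, map_sub, map_mul, map_pow] at h1 ⊢
        linarith

end

section

/-! ### The homology of the complex of ideals -/

variable {V : Type*} [AddCommGroup V] [Module ℝ V] {R : Rect} {M : MeshData} {m m' : ℕ}

/-- The multiples of the vertex `γ` that are boundaries of chains with coefficients in `J`. -/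
def boundaryCoeff (R : Rect) (M : MeshData) (J : Edge → Submodule ℝ V) (γ : ℝ × ℝ) :
    Submodule ℝ V where
  carrier := {q | IsBoundary R M J γ q}
  add_mem' := IsBoundary.add
  zero_mem' := ⟨0, fun _ _ => Submodule.zero_mem _, by simp [MeshData.bd]⟩
  smul_mem' := by
    rintro c q ⟨x, hx, hb⟩
    refine ⟨c • x, fun τ hτ => Submodule.smul_mem _ c (hx τ hτ), fun p hp => ?_⟩
    have h : M.bd (c • x) p = c • M.bd x p := by
      simp [MeshData.bd, Finset.smul_sum, smul_comm _ c]
    rw [h, hb p hp]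
    split_ifs <;> simp

/-- Extension by zero of a function on a finite set. -/
def extendZero {α : Type*} (s : Finset α) : (s → V) →ₗ[ℝ] (α → V) where
  toFun y a := if h : a ∈ s then y ⟨a, h⟩ else 0
  map_add' y z := by
    funext a
    by_cases h : a ∈ s <;> simp [h]
  map_smul' c y := by
    funext a
    by_cases h : a ∈ s <;> simp [h]

theorem extendZero_of_mem {α : Type*} {s : Finset α} (y : s → V) {a : α} (h : a ∈ s) :
    extendZero s y a = y ⟨a, h⟩ := dif_pos h

theorem IsTiling.mem_interiorEdges (hM : IsTiling R M) {τ : Edge} : τ ∈ M.interiorEdges ↔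
    τ ∈ M.edges ∧ ∃ p ∈ τ.toSet, p ∈ R.toSet := by
  rw [MeshData.interiorEdges, Finset.mem_filter, hM.interior_domain]
  rfl

theorem IsTiling.mem_interiorVertices (hM : IsTiling R M) {γ : ℝ × ℝ} : γ ∈ M.interiorVertices ↔
    γ ∈ M.vertices ∧ γ ∈ R.toSet := by
  rw [MeshData.interiorVertices, Finset.mem_filter, hM.interior_domain]

theorem boundary_apply (x : M.interiorEdges → biPoly m m') (γ : M.interiorVertices) :
    boundary M m m' x γ = ∑ τ : M.interiorEdges, τ.1.incidence γ.1 • x τ := by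
  simp [boundary, Edge.incidence]

/-- At interior points, the boundary of a chain depends only on its values on interior edges. -/
theorem IsTiling.bd_eq_boundary (hM : IsTiling R M) (x : Edge → biPoly m m')
    (γ : M.interiorVertices) : M.bd x γ.1 = boundary M m m' (fun τ => x τ.1) γ := by
  rw [boundary_apply, Finset.sum_coe_sort M.interiorEdges fun τ => τ.incidence γ.1 • x τ,
    MeshData.bd]
  symm
  refine Finset.sum_subset (Finset.filter_subset _ _) fun τ hτ hn => ?_
  rw [Edge.incidence_of_not_mem, zero_smul]
  exact fun h => hn (hM.mem_interiorEdges.mpr ⟨hτ, _, h, (hM.mem_interiorVertices.mp γ.2).2⟩)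

/-- If all coefficients in `W` of vertices are boundaries of chains with coefficients in `J`, then
so are all combinations of vertices with such coefficients. -/
theorem IsTiling.exists_boundary_eq (hM : IsTiling R M) {J : Edge → Submodule ℝ (biPoly m m')}
    (w : M.interiorVertices → biPoly m m') (hw : ∀ γ, w γ ∈ boundaryCoeff R M J γ.1) :
    ∃ x : M.interiorEdges → biPoly m m', (∀ τ, x τ ∈ J τ.1) ∧ boundary M m m' x = w := by
  choose x hx hb using hw
  refine ⟨fun τ => ∑ γ, x γ τ.1, fun τ => Submodule.sum_mem _ fun γ _ =>
    hx γ τ.1 (hM.mem_interiorEdges.mp τ.2).1, ?_⟩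
  funext γ
  have h : ∀ γ', boundary M m m' (fun τ => x γ' τ.1) γ = if γ = γ' then w γ' else 0 := by
    intro γ'
    rw [← hM.bd_eq_boundary, hb γ' γ.1 (hM.mem_interiorVertices.mp γ.2).2]
    simp only [Subtype.ext_iff]
  have h' : (fun τ : M.interiorEdges => ∑ γ', x γ' τ.1) = ∑ γ', fun τ => x γ' τ.1 := by
    funext τ
    simp
  rw [h', map_sum, Finset.sum_apply, Finset.sum_congr rfl fun γ' _ => h γ']
  simp

theorem mem_edgeJ {r : SmoothnessDistribution M} {τ : Edge} {q : biPoly m m'} :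
    q ∈ edgeJ r m m' τ ↔ τ.linearForm ^ (r.toFun τ + 1).toNat ∣ (q : MvPolynomial (Fin 2) ℝ) := by
  simp [edgeJ, Ideal.mem_span_singleton]

theorem SmoothnessDistribution.IsBoundedBy.two_mul_le {r : SmoothnessDistribution M}
    (hr : r.IsBoundedBy m m') {τ : Edge} (hτ : τ ∈ M.edges) :
    2 * (r.toFun τ + 1).toNat ≤ τ.dir.flip.deg m m' + 1 := by
  have h : (r.toFun τ : ℝ) ≤ ((τ.dir.flip.deg m m' : ℝ) - 1) / 2 := by
    rcases hd : τ.dir with _ | _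
    · exact (hr τ hτ).1 hd
    · exact (hr τ hτ).2 hd
  have h' : 2 * (r.toFun τ + 1) ≤ (τ.dir.flip.deg m m' : ℤ) + 1 := by
    have : (2 * (r.toFun τ + 1) : ℝ) ≤ (τ.dir.flip.deg m m' : ℝ) + 1 := by linarith
    exact_mod_cast this
  omega

/-- Coefficients in the spaces of a smoothness distribution `s` can be split between two
perpendicular edges with coefficients for a distribution `r` that satisfies the degree bounds. -/
theorem exists_add_of_mem_edgeJ {r : SmoothnessDistribution M} (hr : r.IsBoundedBy m m')
    (s : SmoothnessDistribution M) {τ v₁ v₂ : Edge} (hv₁ : v₁ ∈ M.edges) (hv₂ : v₂ ∈ M.edges)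
    (h₁ : v₁.dir = τ.dir.flip) (h₂ : v₂.dir = τ.dir.flip) (hne : v₁.pos ≠ v₂.pos)
    {q : biPoly m m'} (hq : q ∈ edgeJ s m m' τ) :
    ∃ q₁ q₂, q = q₁ + q₂ ∧ q₁ ∈ edgeJ s m m' τ ∧ q₂ ∈ edgeJ s m m' τ ∧
      q₁ ∈ edgeJ r m m' v₁ ∧ q₂ ∈ edgeJ r m m' v₂ := by
  have b₁ := hr.two_mul_le hv₁
  have b₂ := hr.two_mul_le hv₂
  rw [h₁, Dir.flip_flip] at b₁
  rw [h₂, Dir.flip_flip] at b₂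
  obtain ⟨q₁, q₂, he, hm₁, hm₂, d₁, d₂, d₃, d₄⟩ := exists_add_of_linearForm_pow_dvd
    (k₁ := (r.toFun v₁ + 1).toNat) (k₂ := (r.toFun v₂ + 1).toNat) (m := m) (m' := m') τ v₁ v₂ h₁ h₂
    hne (by omega) q.2 (mem_edgeJ.mp hq)
  exact ⟨⟨q₁, hm₁⟩, ⟨q₂, hm₂⟩, Subtype.ext he, mem_edgeJ.mpr d₁, mem_edgeJ.mpr d₂, mem_edgeJ.mpr d₃,
    mem_edgeJ.mpr d₄⟩

theorem Edge.isConnected_toSet (τ : Edge) : IsConnected τ.toSet := by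
  refine (isConnected_Icc τ.lo_lt_hi.le).image _ (Continuous.continuousOn ?_)
  rcases τ.dir with _ | _
  · exact continuous_id.prodMk continuous_const
  · exact continuous_const.prodMk continuous_id

theorem SmoothnessDistribution.ConstantOnSegments.constantAlong (hM : IsTiling R M)
    {r : SmoothnessDistribution M} (hr : r.ConstantOnSegments) :
    ConstantAlong R M fun τ => edgeJ r m m' τ := by
  intro τ hτ τ' hτ' hd he hR
  have hpos : τ.pos = τ'.pos := by
    have h1 : τ.dir.flip.coord τ.tgt = τ.pos := by simp [Edge.tgt]
    have h2 : τ'.dir.flip.coord τ'.src = τ'.pos := by simp [Edge.src]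
    rw [← h1, ← h2, hd, he]
  have hseg : M.IsSegment {τ, τ'} := by
    refine ⟨?_, by simp, ?_, ?_⟩
    · intro a ha
      rw [Finset.mem_insert, Finset.mem_singleton] at ha
      rcases ha with rfl | rfl
      · exact hM.mem_interiorEdges.mpr ⟨hτ, _, a.tgt_mem, hR⟩
      · exact hM.mem_interiorEdges.mpr ⟨hτ', _, a.src_mem, he ▸ hR⟩
    · rcases h : τ.dir with _ | _
      · exact Or.inl (by simp [h, ← hd])
      · exact Or.inr (by simp [h, ← hd])
    · have h : (⋃ a ∈ ({τ, τ'} : Finset Edge), a.toSet) = τ.toSet ∪ τ'.toSet := by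
        simp
      rw [h]
      exact τ.isConnected_toSet.union ⟨τ.tgt, τ.tgt_mem, he ▸ τ'.src_mem⟩ τ'.isConnected_toSet
  have hr' := hr _ hseg τ (by simp) τ' (by simp)
  have hl : τ.linearForm = τ'.linearForm := by
    rw [Edge.linearForm_eq, Edge.linearForm_eq, hd, hpos]
  simp only [edgeJ, hr', hl]

theorem vertexJ_le_boundaryCoeff (hM : IsTiling R M) {s : SmoothnessDistribution M}
    (h : ∀ τ ∈ M.edges, ∀ q ∈ edgeJ s m m' τ, IsBoundary R M (fun τ => edgeJ s m m' τ) τ.src q)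
    {γ : ℝ × ℝ} (hγ : γ ∈ M.vertices) :
    vertexJ s m m' γ ≤ boundaryCoeff R M (fun τ => edgeJ s m m' τ) γ := by
  refine iSup₂_le fun τ hτ => iSup_le fun hγτ => fun q hq => ?_
  exact IsBoundary.of_src hτ hq (h τ hτ q hq) (hM.eq_end γ hγ τ hτ hγτ)

theorem idealZero_le_map (hM : IsTiling R M) {s : SmoothnessDistribution M}
    (h : ∀ τ ∈ M.edges, ∀ q ∈ edgeJ s m m' τ, IsBoundary R M (fun τ => edgeJ s m m' τ) τ.src q) :
    idealZero s m m' ≤ (idealOne s m m').map (boundary M m m') := by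
  intro w hw
  obtain ⟨x, hx, rfl⟩ := hM.exists_boundary_eq (J := fun τ => edgeJ s m m' τ) w fun γ =>
    vertexJ_le_boundaryCoeff hM h (hM.mem_interiorVertices.mp γ.2).1 (hw γ (Set.mem_univ _))
  exact Submodule.mem_map_of_mem fun τ _ => hx τ

theorem boundary_surjective (hB : Built R M)
    (hc : ∀ γ ∈ M.vertices, γ ∈ R.toSet → M.IsCorner γ) :
    Function.Surjective (boundary M m m') := by
  intro w
  have hM := hB.isTiling
  obtain ⟨x, -, hx⟩ := hM.exists_boundary_eq (J := fun _ => ⊤) w fun γ => by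
    have hγ := hM.mem_interiorVertices.mp γ.2
    obtain ⟨τ, hτ, -, he⟩ := hc γ.1 hγ.1 hγ.2 .horizontal
    refine IsBoundary.of_src (J := fun _ => ⊤) hτ Submodule.mem_top ?_ he
    refine hB.isBoundary _ (fun _ _ _ _ _ _ _ => rfl) ?_ τ hτ _ Submodule.mem_top
    exact fun _ _ _ _ _ _ _ _ _ q _ => ⟨q, 0, by simp⟩
  exact ⟨x, hx⟩

/-! ### Splines as the kernel of the jump map -/

/-- The jumps across the interior edges of a family of polynomials on the faces. -/
def jumpMap (M : MeshData) (m m' : ℕ) :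
    (M.faces → biPoly m m') →ₗ[ℝ] (M.interiorEdges → biPoly m m') where
  toFun y τ := M.jump (extendZero M.faces y) τ.1
  map_add' y z := by
    funext τ
    rw [map_add, MeshData.jump_add]
    rfl
  map_smul' c y := by
    funext τ
    rw [map_smul, MeshData.jump_smul]
    rfl

theorem Built.range_jumpMap (hB : Built R M) :
    LinearMap.range (jumpMap M m m') = LinearMap.ker (boundary M m m') := by
  have hM := hB.isTiling
  ext x
  rw [LinearMap.mem_range, LinearMap.mem_ker]
  constructor
  · rintro ⟨y, rfl⟩
    funext γ
    have h := hM.bd_eq_boundary (M.jump (extendZero M.faces y)) γ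
    rw [hM.bd_jump _ (hM.mem_interiorVertices.mp γ.2).2] at h
    exact h.symm
  · intro hx
    have hxe : (fun τ : M.interiorEdges => extendZero M.interiorEdges x τ.1) = x :=
      funext fun τ => extendZero_of_mem x τ.2
    obtain ⟨y, hy⟩ := hB.exists_jump (extendZero M.interiorEdges x) fun p hp => by
      by_cases hv : p ∈ M.vertices
      · rw [hM.bd_eq_boundary _ ⟨p, hM.mem_interiorVertices.mpr ⟨hv, hp⟩⟩, hxe, hx]
        rfl
      · refine Finset.sum_eq_zero fun τ hτ => ?_
        have h1 : p ≠ τ.tgt := fun h => hv (h ▸ hM.tgt_mem τ hτ)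
        have h2 : p ≠ τ.src := fun h => hv (h ▸ hM.src_mem τ hτ)
        simp [Edge.incidence, h1, h2]
    refine ⟨fun σ => y σ.1, funext fun τ => ?_⟩
    obtain ⟨hτ, p, hp, hpR⟩ := hM.mem_interiorEdges.mp τ.2
    have h3 := hy τ.1 hτ p hp hpR
    rw [extendZero_of_mem x τ.2] at h3
    rw [h3]
    obtain ⟨A, hA, hAs⟩ := hM.exists_isSide τ.1 hτ p hp hpR true
    obtain ⟨B, hB', hBs⟩ := hM.exists_isSide τ.1 hτ p hp hpR false
    change M.jump _ _ = _
    rw [hM.jump_eq _ hA hB' hAs hBs, hM.jump_eq _ hA hB' hAs hBs, extendZero_of_mem _ hA,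
      extendZero_of_mem _ hB']

/-- The face that contains a given point. -/
def MeshData.faceOf (M : MeshData) (x : M.faceUnion) : M.faces :=
  ⟨(Set.mem_iUnion₂.mp x.2).choose, (Set.mem_iUnion₂.mp x.2).choose_spec.choose⟩

theorem IsTiling.faceOf_eq (hM : IsTiling R M) {x : M.faceUnion} {σ : Rect} (hσ : σ ∈ M.faces)
    (hx : x.1 ∈ σ.toSet) : M.faceOf x = ⟨σ, hσ⟩ :=
  Subtype.ext (hM.germ_unique .horizontal true true x.1 _ (M.faceOf x).2 σ hσ
    (Rect.germ_of_mem (Set.mem_iUnion₂.mp x.2).choose_spec.choose_spec _ _ _)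
    (Rect.germ_of_mem hx _ _ _))

/-- The piecewise polynomial function given by a family of polynomials on the faces. -/
def piecewise (M : MeshData) (m m' : ℕ) :
    (M.faces → biPoly m m') →ₗ[ℝ] (M.faceUnion → ℝ) where
  toFun y x := evalAt (y (M.faceOf x)) x.1
  map_add' y z := by
    funext x
    simp [evalAt]
  map_smul' c y := by
    funext x
    simp [evalAt]

theorem eq_zero_of_evalAt (σ : Rect) {p : MvPolynomial (Fin 2) ℝ}
    (h : ∀ x ∈ σ.toSet, evalAt p x = 0) : p = 0 := by
  apply MvPolynomial.funext_set ![Set.Ioo σ.left σ.right, Set.Ioo σ.bottom σ.top]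
  · intro i
    fin_cases i
    · exact Set.Ioo_infinite σ.left_lt_right
    · exact Set.Ioo_infinite σ.bottom_lt_top
  · intro x hx
    have h0 := hx 0 (Set.mem_univ _)
    have h1 := hx 1 (Set.mem_univ _)
    have h2 := h (x 0, x 1) ⟨h0, h1⟩
    have h3 : ![x 0, x 1] = x := by
      funext i
      fin_cases i <;> rfl
    rw [evalAt, h3] at h2
    rw [h2, map_zero]

theorem IsTiling.piecewise_apply (hM : IsTiling R M) (y : M.faces → biPoly m m')
    {σ : Rect} (hσ : σ ∈ M.faces) (x : M.faceUnion) (hx : x.1 ∈ σ.toSet) :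
    piecewise M m m' y x = evalAt (y ⟨σ, hσ⟩) x.1 := by
  rw [← hM.faceOf_eq hσ hx]
  rfl

theorem IsTiling.piecewise_injective (hM : IsTiling R M) :
    Function.Injective (piecewise M m m') := by
  rw [← LinearMap.ker_eq_bot, LinearMap.ker_eq_bot']
  intro y hy
  funext σ
  refine Subtype.ext (eq_zero_of_evalAt σ.1 fun x hx => ?_)
  rw [← hM.piecewise_apply y σ.2 ⟨x, MeshData.mem_faceUnion σ.2 hx⟩ hx, hy]
  rfl

/-- A piecewise polynomial function is a spline if and only if its jumps are in the spaces of the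
smoothness distribution. -/
theorem IsTiling.splineSpace_eq_map (hM : IsTiling R M) (s : SmoothnessDistribution M) :
    splineSpace M s m m' =
      ((idealOne s m m').comap (jumpMap M m m')).map (piecewise M m m') := by
  have key : ∀ y : M.faces → biPoly m m', y ∈ (idealOne s m m').comap (jumpMap M m m') ↔
      ∀ τ ∈ M.interiorEdges, SmoothAcross M (piecewise M m m' y) τ (s.toFun τ) := by
    intro y
    have hJ : y ∈ (idealOne s m m').comap (jumpMap M m m') ↔ ∀ τ ∈ M.interiorEdges,
        M.jump (extendZero M.faces y) τ ∈ edgeJ s m m' τ := by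
      rw [Submodule.mem_comap]
      exact ⟨fun h τ hτ => h ⟨τ, hτ⟩ (Set.mem_univ _), fun h τ _ => h τ.1 τ.2⟩
    rw [hJ]
    refine forall₂_congr fun τ hτ => ?_
    obtain ⟨hτ, p, hp, hpR⟩ := hM.mem_interiorEdges.mp hτ
    obtain ⟨A, hA, hAs⟩ := hM.exists_isSide τ hτ p hp hpR true
    obtain ⟨B, hB, hBs⟩ := hM.exists_isSide τ hτ p hp hpR false
    rw [hM.jump_eq _ hA hB hAs hBs, extendZero_of_mem _ hA, extendZero_of_mem _ hB,
      Submodule.smul_mem_iff _ (left_ne_zero_of_mul_eq_one τ.dir.sign_mul_self), mem_edgeJ,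
      hM.smoothAcross_iff hτ hA hB hAs hBs (y ⟨A, hA⟩).2 (y ⟨B, hB⟩).2
        (hM.piecewise_apply y hA) (hM.piecewise_apply y hB)]
    rfl
  ext f
  rw [Submodule.mem_map]
  constructor
  · rintro ⟨hf, hf'⟩
    choose p hp hfp using hf
    have hpw : piecewise M m m' (fun σ => ⟨p σ.1 σ.2, hp σ.1 σ.2⟩) = f := by
      funext x
      obtain ⟨σ, hσ, hx⟩ := Set.mem_iUnion₂.mp x.2
      rw [hM.piecewise_apply _ hσ x hx, hfp σ hσ x hx]
    exact ⟨_, (key _).mpr (by rwa [hpw]), hpw⟩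
  · rintro ⟨y, hy, rfl⟩
    exact ⟨fun σ hσ => ⟨y ⟨σ, hσ⟩, (y ⟨σ, hσ⟩).2, fun x hx => hM.piecewise_apply y hσ x hx⟩,
      (key y).mp hy⟩

/-! ### The dimension formula -/

/-- If `U₂ → U₁ → U₀ → 0` is exact and the second map sends `I₁` onto `I₀`, then the induced
sequence `U₂ → U₁ ⧸ I₁ → U₀ ⧸ I₀ → 0` is exact. -/
theorem finrank_comap_add_finrank_quotient {U₂ U₁ U₀ : Type*} [AddCommGroup U₂] [Module ℝ U₂]
    [AddCommGroup U₁] [Module ℝ U₁] [AddCommGroup U₀] [Module ℝ U₀] [FiniteDimensional ℝ U₂]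
    [FiniteDimensional ℝ U₁] (f : U₂ →ₗ[ℝ] U₁) (g : U₁ →ₗ[ℝ] U₀)
    (hfg : LinearMap.range f = LinearMap.ker g) (hg : Function.Surjective g)
    {I₁ : Submodule ℝ U₁} {I₀ : Submodule ℝ U₀} (h : I₁ ≤ I₀.comap g) (h' : I₀ ≤ I₁.map g) :
    Module.finrank ℝ (I₁.comap f) + Module.finrank ℝ (U₁ ⧸ I₁) =
      Module.finrank ℝ U₂ + Module.finrank ℝ (U₀ ⧸ I₀) := by
  have h1 := LinearMap.finrank_range_add_finrank_ker (I₁.mkQ ∘ₗ f)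
  have h2 := LinearMap.finrank_range_add_finrank_ker (I₁.mapQ I₀ g h)
  have hs : Function.Surjective (I₁.mapQ I₀ g h) := by
    intro z
    obtain ⟨z, rfl⟩ := I₀.mkQ_surjective z
    obtain ⟨v, rfl⟩ := hg z
    exact ⟨I₁.mkQ v, by simp⟩
  have hker : LinearMap.ker (I₁.mapQ I₀ g h) = LinearMap.range (I₁.mkQ ∘ₗ f) := by
    ext z
    obtain ⟨v, rfl⟩ := I₁.mkQ_surjective z
    simp only [LinearMap.mem_ker, Submodule.mkQ_apply, Submodule.mapQ_apply,
      Submodule.Quotient.mk_eq_zero, LinearMap.mem_range, LinearMap.comp_apply,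
      Submodule.Quotient.eq]
    constructor
    · intro hv
      obtain ⟨i, hi, hiv⟩ := h' hv
      have : v - i ∈ LinearMap.range f := by
        rw [hfg, LinearMap.mem_ker, map_sub, hiv, sub_self]
      obtain ⟨u, hu⟩ := this
      exact ⟨u, by rw [hu]; simpa using I₁.neg_mem hi⟩
    · rintro ⟨u, hu⟩
      have h3 : g (f u) = 0 := by
        have : f u ∈ LinearMap.ker g := hfg ▸ LinearMap.mem_range_self f u
        exact this
      have h4 : g (f u - v) ∈ I₀ := h hu
      rw [map_sub, h3, zero_sub] at h4
      simpa using I₀.neg_mem h4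
  have hker' : LinearMap.ker (I₁.mkQ ∘ₗ f) = I₁.comap f := by
    rw [LinearMap.ker_comp, Submodule.ker_mkQ]
  rw [hker'] at h1
  rw [hker, LinearMap.range_eq_top.mpr hs, finrank_top] at h2
  omega

theorem finrank_splineSpace (hB : Built R M) (hc : ∀ γ ∈ M.vertices, γ ∈ R.toSet → M.IsCorner γ)
    {s : SmoothnessDistribution M} (h : ∀ τ ∈ M.edges, ∀ q ∈ edgeJ s m m' τ,
      IsBoundary R M (fun τ => edgeJ s m m' τ) τ.src q) :
    FiniteDimensional ℝ (splineSpace M s m m') ∧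
      (Module.finrank ℝ (splineSpace M s m m') : ℤ) = eulerChar s m m' := by
  have hM := hB.isTiling
  have e := Submodule.equivMapOfInjective _ hM.piecewise_injective
    ((idealOne s m m').comap (jumpMap M m m'))
  rw [hM.splineSpace_eq_map]
  refine ⟨e.finiteDimensional, ?_⟩
  rw [← e.finrank_eq]
  have h1 := finrank_comap_add_finrank_quotient (jumpMap M m m') (boundary M m m')
    hB.range_jumpMap (boundary_surjective hB hc) (I₁ := idealOne s m m') (I₀ := idealZero s m m')
    (fun x hx => boundary_mem s m m' hx) (idealZero_le_map hM h)
  have e1 : Module.finrank ℝ ((M.interiorEdges → biPoly m m') ⧸ idealOne s m m') =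
      Module.finrank ℝ (quotOne s m m') :=
    (Submodule.quotientPi fun τ : M.interiorEdges => edgeJ s m m' τ.1).finrank_eq
  have e0 : Module.finrank ℝ ((M.interiorVertices → biPoly m m') ⧸ idealZero s m m') =
      Module.finrank ℝ (quotZero s m m') :=
    (Submodule.quotientPi fun γ : M.interiorVertices => vertexJ s m m' γ.1).finrank_eq
  rw [e1, e0] at h1
  rw [eulerChar]
  change _ = (Module.finrank ℝ (M.faces → biPoly m m') : ℤ) - _ + _
  omega

end

end TSpline

end

open TSpline in
theorem mainTheorem5 (T : TSpline.TMesh) (hT : T.toMeshData.IsHierarchical) (m m' : ℕ)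
    (r : TSpline.SmoothnessDistribution T.toMeshData)
    (hr : r.IsBoundedBy m m') (hconst : r.ConstantOnSegments) :
    Subsingleton (TSpline.idealHomologyZero r m m') ∧
    ∀ s : TSpline.SmoothnessDistribution T.toMeshData,
      (∀ τ ∈ T.edges, s.toFun τ ≤ r.toFun τ) →
      FiniteDimensional ℝ (TSpline.splineSpace T.toMeshData s m m') ∧
      (Module.finrank ℝ (TSpline.splineSpace T.toMeshData s m m') : ℤ) =
        TSpline.eulerChar s m m' := by
  obtain ⟨R, hB, hc⟩ := hT.exists_built
  have hM := hB.isTiling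
  have hbr := hB.isBoundary (fun τ => edgeJ r m m' τ) (hconst.constantAlong hM)
    fun τ _ v₁ hv₁ v₂ hv₂ h₁ h₂ hne q hq => exists_add_of_mem_edgeJ hr r hv₁ hv₂ h₁ h₂ hne hq
  refine ⟨?_, fun s hs => finrank_splineSpace hB hc fun τ hτ q hq => ?_⟩
  · rw [Submodule.Quotient.subsingleton_iff, LinearMap.range_eq_top]
    rintro ⟨w, hw⟩
    obtain ⟨x, hx, rfl⟩ := idealZero_le_map hM hbr hw
    exact ⟨⟨x, hx⟩, rfl⟩
  · refine IsBoundary.of_le hM hc hbr (fun τ hτ q hq => ?_)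
      (fun τ _ v₁ hv₁ v₂ hv₂ h₁ h₂ hne q hq => exists_add_of_mem_edgeJ hr s hv₁ hv₂ h₁ h₂ hne hq)
      hτ hq
    have hle := hs τ hτ
    exact mem_edgeJ.mpr ((pow_dvd_pow _ (by omega)).trans (mem_edgeJ.mp hq))
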